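/- Fix $\lambda>0$ and consider the symmetric one-dimensional Bernoulli displacement model: $\omega=(\omega_k)_{k\in\mathbb Z}$ are i.i.d. with $\mathbb P(\omega_k=0)=\mathbb P(\omega_k=1)=\tfrac12$, $V_\omega(n)=\lambda\sum_{k\in\mathbb Z}\delta_{n,\,2k+1+\omega_k}$, and $(h_{\omega,\lambda}u)(n)=-u(n-1)-u(n+1)+V_\omega(n)u(n)$ on $\ell^2(\mathbb Z)$. Let $\Sigma_\lambda$ be the almost-sure spectrum of $h_{\omega,\lambda}$ and put $E_-(\lambda)=\inf\Sigma_\lambda$, $E_+(\lambda)=\sup\Sigma_\lambda$. Let $\omega^*_k=0$ for even $k$ and $\omega^*_k=1$ for odd $k$, and let $(G_-(\lambda),G_+(\lambda))$ be the central gap of $\sigma(h_{\omega^*,\lambda})$, i.e. the gap containing the centre of symmetry $\lambda/2$ of this spectrum. Let $h^L_{\omega,\lambda}$ be the restriction of $h_{\omega,\lambda}$ to $\{1,\dots,2L\}$ with boundary conditions given by real numbers (which may depend on $L$) added to the first and the last diagonal matrix element, and let $E_1(h^L_{\omega,\lambda})\le E_2(h^L_{\omega,\lambda})\le\dots$ be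 its eigenvalues, counted with multiplicity. Then for every $E\in\mathbb R$ the limit $$N_\lambda(E)=\lim_{L\to\infty}\frac1{2L}\,\mathbb E\bigl(\#\{k: E_k(h^L_{\omega,\lambda})\le E\}\bigr)$$ (the integrated density of states, IDS) exists and does not depend on the boundary conditions, and the following hold. (a) If $E_0=E_-(\lambda)$ or $E_0=G_+(\lambda)$, there are constants $C,\varepsilon>0$ such that $$N_\lambda(E)-N_\lambda(E_0)\ \ge\ \frac{C}{\log^2(E-E_0)}\qquad\text{for all }E\in(E_0,E_0+\varepsilon).$$ (b) If $E_0=E_+(\lambda)$ or $E_0=G_-(\lambda)$, there are constants $C,\varepsilon>0$ such that $$N_\lambda(E_0)-N_\lambda(E)\ \ge\ \frac{C}{\log^2(E_0-E)}\qquad\text{for all }E\in(E_0-\varepsilon,E_0).$$ (c) Consequently, at each of the four edges $E_0\in\{E_-(\lambda),E_+(\lambda),G_-(\lambda),G_+(\lambda)\}$ the IDS is not Hölder continuous: there are no $\gamma>0$, $K\in\mathbb R$, $\delta>0$ with $|N_\lambda(E)-N_\lambda(E_0)|\le K|E-E_0|^\gamma$ whenever $|E-E_0|<\delta$. -/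

import Mathlib

open MeasureTheory Filter Topology

noncomputable section

namespace BDM

/-! ## The Bernoulli displacement model on `ℓ²(ℤ)` -/

/-- A displacement configuration: in the cell `{2k+1, 2k+2}` the single-site term is displaced by
`ω k ∈ {0, 1}`. -/
abbrev Config : Type := ℤ → Fin 2

/-- The law of one displacement: `0` and `1` with probability `1/2` each. -/
def siteLaw : Measure (Fin 2) :=
  (PMF.uniformOfFintype (Fin 2)).toMeasure

instance : IsProbabilityMeasure siteLaw := by
  unfold siteLaw; infer_instance

/-- The displacements are i.i.d.: the infinite product measure on configurations. -/
def law : Measure Config := Measure.infinitePi fun _ : ℤ => siteLaw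

/-- The single-site potential `q = lam * δ_1`. -/
def singleSite (lam : ℝ) (n : ℤ) : ℝ := if n = 1 then lam else 0

/-- The potential `V_ω(n) = ∑_k q(n - (2k + ω_k))`; for each `n` at most one term is nonzero. -/
def potential (lam : ℝ) (ω : Config) (n : ℤ) : ℝ :=
  ∑ᶠ k : ℤ, singleSite lam (n - (2 * k + ((ω k : ℕ) : ℤ)))

/-- The potential at `n` is decided by the displacement in the cell of `n`. -/
theorem potential_eq (lam : ℝ) (ω : Config) (n : ℤ) :
    potential lam ω n = if n = 2 * ((n - 1) / 2) + ((ω ((n - 1) / 2) : ℕ) : ℤ) + 1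
      then lam else 0 := by
  unfold potential
  rw [finsum_eq_single _ ((n - 1) / 2)]
  · unfold singleSite
    congr 1
    apply propext
    constructor <;> intro h <;> linarith
  · intro k hk
    unfold singleSite
    rw [if_neg]
    intro h
    have := (ω k).isLt
    omega

theorem norm_potential_le (lam : ℝ) (ω : Config) (n : ℤ) : |potential lam ω n| ≤ |lam| := by
  rw [potential_eq]; split_ifs <;> simp

/-- The Hilbert space `ℓ²(ℤ)`. -/
abbrev Ell2 : Type := lp (fun _ : ℤ => ℂ) 2

/-- The translation `(shift j u)(n) = u(n + j)` on `ℓ²(ℤ)`. -/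
def shift (j : ℤ) : Ell2 →L[ℂ] Ell2 :=
  LinearMap.mkContinuous
    { toFun := fun u => ⟨fun n => u (n + j), by
        refine memℓp_gen ?_
        exact ((Equiv.addRight j).summable_iff
          (f := fun n => ‖u n‖ ^ (2 : ENNReal).toReal)).2 ((lp.memℓp u).summable (by simp))⟩
      map_add' := fun u v => rfl
      map_smul' := fun c u => rfl } 1 (by
    intro u
    rw [one_mul]
    refine lp.norm_le_of_tsum_le (by simp) (norm_nonneg _) ?_
    rw [lp.norm_rpow_eq_tsum (by simp) u]
    exact ((Equiv.addRight j).tsum_eq (fun n => ‖u n‖ ^ (2 : ENNReal).toReal)).le)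

@[simp] theorem shift_apply (j : ℤ) (u : Ell2) (n : ℤ) : shift j u n = u (n + j) := rfl

/-- Multiplication by the potential on `ℓ²(ℤ)`. -/
def mulPotential (lam : ℝ) (ω : Config) : Ell2 →L[ℂ] Ell2 :=
  have key : ∀ (u : Ell2) (n : ℤ),
      ‖(potential lam ω n : ℂ) * u n‖ ≤ ‖((|lam| : ℝ) • u) n‖ := by
    intro u n
    rw [lp.coeFn_smul, Pi.smul_apply, norm_mul, norm_smul, Complex.norm_real, Real.norm_eq_abs,
      Real.norm_eq_abs, abs_abs]
    exact mul_le_mul_of_nonneg_right (norm_potential_le lam ω n) (norm_nonneg _)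
  LinearMap.mkContinuous
    { toFun := fun u => ⟨fun n => (potential lam ω n : ℂ) * u n,
        (lp.memℓp ((|lam| : ℝ) • u)).mono' (key u)⟩
      map_add' := fun u v => by
        ext n
        exact mul_add (potential lam ω n : ℂ) (u n) (v n)
      map_smul' := fun c u => by
        ext n
        exact mul_left_comm (potential lam ω n : ℂ) c (u n) } |lam| (by
    intro u
    refine (lp.norm_mono (p := 2) (by simp) (y := (|lam| : ℝ) • u) (fun n => key u n)).trans ?_
    refine (lp.norm_const_smul_le (by simp) _ _).trans ?_
    rw [Real.norm_eq_abs, abs_abs])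

@[simp] theorem mulPotential_apply (lam : ℝ) (ω : Config) (u : Ell2) (n : ℤ) :
    mulPotential lam ω u n = (potential lam ω n : ℂ) * u n := rfl

/-- The bounded operator `h_{ω,λ} = h_0 + V_ω` on `ℓ²(ℤ)`. -/
def hamiltonian (lam : ℝ) (ω : Config) : Ell2 →L[ℂ] Ell2 :=
  -(shift (-1) + shift 1) + mulPotential lam ω

theorem hamiltonian_apply (lam : ℝ) (ω : Config) (u : Ell2) (n : ℤ) :
    hamiltonian lam ω u n
      = -(u (n - 1) + u (n + 1)) + (potential lam ω n : ℂ) * u n := rfl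

/-- The spectrum of `h_{ω,λ}`, as a set of reals (the operator is self-adjoint). -/
def spec (lam : ℝ) (ω : Config) : Set ℝ :=
  {E | (E : ℂ) ∈ spectrum ℂ (hamiltonian lam ω)}

/-! ## The band edges -/

/-- The almost-sure spectrum: the energies that lie in the spectrum of `h_{ω,λ}` for almost every
`ω`. If the spectrum equals one fixed set almost surely, then this is that set. -/
def asSpec (lam : ℝ) : Set ℝ := {E | ∀ᵐ ω ∂law, E ∈ spec lam ω}

/-- `E_-(λ)`, the lower edge of the almost-sure spectrum. -/
def lowerEdge (lam : ℝ) : ℝ := sInf (asSpec lam)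

/-- `E_+(λ)`, the upper edge of the almost-sure spectrum. -/
def upperEdge (lam : ℝ) : ℝ := sSup (asSpec lam)

/-- The configuration `ω*`, whose potential is 4-periodic with two adjacent values `lam` followed by
two adjacent values `0`. -/
def omegaStar : Config := fun k => if Even k then 0 else 1

/-- `G_-(λ)`, the lower edge of the central spectral gap of `h_{ω*,λ}`. The spectrum is symmetric
about `lam / 2`, so the central gap is the one around `lam / 2`. -/
def gapLower (lam : ℝ) : ℝ := sSup (spec lam omegaStar ∩ Set.Iic (lam / 2))

/-- `G_+(λ)`, the upper edge of the central spectral gap of `h_{ω*,λ}`. -/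
def gapUpper (lam : ℝ) : ℝ := sInf (spec lam omegaStar ∩ Set.Ici (lam / 2))

/-! ## The integrated density of states -/

/-- The restriction of `h_{ω,λ}` to `{1, …, 2L}` (index `i` stands for the site `i + 1`), with
boundary condition `a` at the left end and `b` at the right end, added to the diagonal. -/
def boxMatrix (lam a b : ℝ) (ω : Config) (L : ℕ) : Matrix (Fin (2 * L)) (Fin (2 * L)) ℝ :=
  Matrix.of fun i j =>
    if i = j then
      potential lam ω ((i : ℕ) + 1 : ℤ) + (if (i : ℕ) = 0 then a else 0)
        + (if (i : ℕ) + 1 = 2 * L then b else 0)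
    else if (i : ℕ) + 1 = j ∨ (j : ℕ) + 1 = i then -1 else 0

theorem boxMatrix_isHermitian (lam a b : ℝ) (ω : Config) (L : ℕ) :
    (boxMatrix lam a b ω L).IsHermitian := by
  ext i j
  simp only [Matrix.conjTranspose_apply, star_trivial, boxMatrix, Matrix.of_apply]
  by_cases h : i = j
  · subst h; rfl
  · rw [if_neg h, if_neg (Ne.symm h)]
    simp only [or_comm]

/-- The number of eigenvalues `≤ E` of the restriction, counted with multiplicity. -/
def eigCount (lam a b : ℝ) (ω : Config) (L : ℕ) (E : ℝ) : ℕ :=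
  Nat.card {k : Fin (2 * L) // (boxMatrix_isHermitian lam a b ω L).eigenvalues k ≤ E}

/-- The finite-volume integrated density of states `|Λ(L)|⁻¹ 𝔼(#{k : E_k ≤ E})`. -/
def boxIDS (lam a b : ℝ) (L : ℕ) (E : ℝ) : ℝ :=
  (1 / (2 * L : ℝ)) * ∫ ω, (eigCount lam a b ω L E : ℝ) ∂law

/-- The integrated density of states `N_λ(E)`, the limit of the finite-volume ones. -/
def IDS (lam E : ℝ) : ℝ := limUnder atTop fun L : ℕ => boxIDS lam 0 0 L E

/-- `f` is Hölder continuous at `x`, with some positive exponent. -/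
def HolderContinuousAt (f : ℝ → ℝ) (x : ℝ) : Prop :=
  ∃ γ > (0 : ℝ), ∃ K : ℝ, ∃ δ > (0 : ℝ), ∀ y : ℝ, |y - x| < δ → |f y - f x| ≤ K * |y - x| ^ γ

end BDM

end

/-!
Write `r = lam / 2` and `s = √(r ^ 2 + 1)`.

**Edges.** Up to the constant `r`, the Hamiltonian is the sum of an operator acting inside the cells
`{2k + 1, 2k + 2}`, whose square is `s ^ 2` because the centred potential anticommutes with the
exchange of the two sites, and of minus the exchange of sites along the bonds between cells, of norm
`1`. Hence every `h_ω` has its spectrum in `s - 1 ≤ |E - r| ≤ s + 1` (`abs_sub_le_of_mem_spec`,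
`le_abs_sub_of_mem_spec`). The roots of `c ^ 2 + lam * c = 1` are `c = ± s - r`, and the energies
`-1 - c` are the two values `r - s - 1` and `r + s - 1`. At such an energy the alternating
configuration has the bounded solution `1, c, c, 1, 1, c, c, 1, …`; cut-offs of it show that the
energy lies in the spectrum as soon as long alternating words occur, which they do almost surely
(`mem_spec_of_alternating`, `ae_exists_word`). So `-1 - c` is `E_-` or `G_+`; the edges `E_+` and
`G_-` are their images under `E ↦ lam - E`, a symmetry of the model implemented by `(-1) ^ n` and
the flip of all displacements.

**Existence of the density of states.** With the boundary condition `1` at both ends the eigenvalue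
counting function is superadditive in the box, since cutting a bond raises the form by a square
(`boxForm_add_le`). Fekete's lemma gives the limit, which is a supremum, so that every single box
bounds it below (`boxIDS_le_IDS`). Other boundary conditions change the count by at most `2`.

**The singularity.** At the energy `-1 - c` the solution that is equal on the two sites of each bond
between cells is multiplied by `c` or `1 / c` in each cell, according to the displacement: its
logarithm is `log |c|` times a simple random walk (`growth_sq`). With probability bounded below the
walk makes an excursion of height of order `√m` within `2m` cells (`law_bump_ge`, a second moment
estimate). The solution restricted to the box is then an approximate eigenvector with an error
`exp (-κ √m)`, which gives an eigenvalue at this distance from the edge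
(`exists_eigenvalue_of_growth`). Taking `m` of order `log² δ` yields one additional state below
`-1 - c + δ` per `log² δ` cells. That it is additional follows from counting at the edge: for `E_-`
there are no states below, and for `G_+` exactly half of the states are, because the form splits
into cells and nonnegative bonds (`boxForm_sub_eq`, `eigCount_le_half`, `half_le_eigCount`).
-/

noncomputable section

namespace BDM

/-! ### Counting eigenvalues of real symmetric matrices -/

section EigenvalueCounting

variable {n : Type*} [Fintype n] [DecidableEq n] {A : Matrix n n ℝ}

/-- The coordinates of a vector in the eigenbasis of a real symmetric matrix. -/
def eigenCoord (hA : A.IsHermitian) : (n → ℝ) ≃ₗ[ℝ] (n → ℝ) :=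
  (WithLp.linearEquiv 2 ℝ (n → ℝ)).symm ≪≫ₗ hA.eigenvectorBasis.repr.toLinearEquiv ≪≫ₗ
    WithLp.linearEquiv 2 ℝ (n → ℝ)

theorem eigenCoord_apply (hA : A.IsHermitian) (x : n → ℝ) (k : n) :
    eigenCoord hA x k = (hA.eigenvectorBasis k).ofLp ⬝ᵥ x := by
  simp [eigenCoord, OrthonormalBasis.repr_apply_apply, PiLp.inner_apply, dotProduct, mul_comm]

theorem eigenCoord_dotProduct (hA : A.IsHermitian) (x y : n → ℝ) :
    eigenCoord hA x ⬝ᵥ eigenCoord hA y = x ⬝ᵥ y := by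
  have h := hA.eigenvectorBasis.repr.inner_map_map (WithLp.toLp 2 y) (WithLp.toLp 2 x)
  simp only [PiLp.inner_apply, RCLike.inner_apply, conj_trivial] at h
  exact h

theorem eigenCoord_mulVec (hA : A.IsHermitian) (x : n → ℝ) (k : n) :
    eigenCoord hA (A.mulVec x) k = hA.eigenvalues k * eigenCoord hA x k := by
  rw [eigenCoord_apply, eigenCoord_apply, Matrix.dotProduct_mulVec, ← Matrix.mulVec_transpose]
  have : A.transpose = A := by simpa [Matrix.IsHermitian] using hA
  rw [this, hA.mulVec_eigenvectorBasis, smul_dotProduct, smul_eq_mul]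

theorem dotProduct_mulVec_eq_sum (hA : A.IsHermitian) (x : n → ℝ) :
    x ⬝ᵥ A.mulVec x = ∑ k, hA.eigenvalues k * eigenCoord hA x k ^ 2 := by
  rw [← eigenCoord_dotProduct hA, dotProduct]
  refine Finset.sum_congr rfl fun k _ => ?_
  rw [eigenCoord_mulVec]; ring

theorem dotProduct_self_eq_sum (hA : A.IsHermitian) (x : n → ℝ) :
    x ⬝ᵥ x = ∑ k, eigenCoord hA x k ^ 2 := by
  rw [← eigenCoord_dotProduct hA, dotProduct]
  exact Finset.sum_congr rfl fun k _ => (sq _).symm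

/-- A linear map from a space of larger dimension than the number of prescribed vanishing
eigencoordinates hits a vector for which they vanish. -/
theorem exists_eigenCoord_eq_zero (hA : A.IsHermitian) {V : Type*} [AddCommGroup V] [Module ℝ V]
    [FiniteDimensional ℝ V] (f : V →ₗ[ℝ] (n → ℝ)) (p : n → Prop)
    (h : Nat.card {k // p k} < Module.finrank ℝ V) :
    ∃ v : V, v ≠ 0 ∧ ∀ k, p k → eigenCoord hA (f v) k = 0 := by
  classical
  let g : V →ₗ[ℝ] ({k // p k} → ℝ) :=
    LinearMap.pi fun k => (LinearMap.proj k.1) ∘ₗ (eigenCoord hA).toLinearMap ∘ₗ f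
  have hg : LinearMap.ker g ≠ ⊥ := by
    apply LinearMap.ker_ne_bot_of_finrank_lt
    rwa [Module.finrank_fintype_fun_eq_card, ← Nat.card_eq_fintype_card]
  obtain ⟨v, hv, hv0⟩ := (Submodule.ne_bot_iff _).1 hg
  exact ⟨v, hv0, fun k hk => congrFun (LinearMap.mem_ker.1 hv) ⟨k, hk⟩⟩

theorem card_add_card_not {n : Type*} [Fintype n] (p : n → Prop) :
    Nat.card {k // p k} + Nat.card {k // ¬ p k} = Fintype.card n := by
  classical
  rw [← Nat.card_sum, Nat.card_congr (Equiv.sumCompl p), Nat.card_eq_fintype_card]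

/-- Min-max, lower bound on the counting function: if the form is at most `E` on a subspace, then
at least as many eigenvalues as its dimension are at most `E`. -/
theorem finrank_le_card_eigenvalues_le (hA : A.IsHermitian) {V : Type*} [AddCommGroup V]
    [Module ℝ V] [FiniteDimensional ℝ V] (f : V →ₗ[ℝ] (n → ℝ)) (hf : Function.Injective f) (E : ℝ)
    (h : ∀ v, f v ⬝ᵥ A.mulVec (f v) ≤ E * (f v ⬝ᵥ f v)) :
    Module.finrank ℝ V ≤ Nat.card {k // hA.eigenvalues k ≤ E} := by
  by_contra! hlt
  obtain ⟨v, hv0, hv⟩ := exists_eigenCoord_eq_zero hA f _ hlt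
  have hne : eigenCoord hA (f v) ≠ 0 := by
    rw [Ne, LinearEquiv.map_eq_zero_iff]
    exact fun h0 => hv0 (hf (h0.trans (map_zero f).symm))
  obtain ⟨k, hk⟩ := Function.ne_iff.1 hne
  have h1 := h v
  rw [dotProduct_mulVec_eq_sum hA, dotProduct_self_eq_sum hA, Finset.mul_sum] at h1
  refine absurd h1 (not_le.2 (Finset.sum_lt_sum (fun i _ => ?_) ⟨k, Finset.mem_univ _, ?_⟩))
  · by_cases hi : hA.eigenvalues i ≤ E
    · simp [hv i hi]
    · exact mul_le_mul_of_nonneg_right (not_le.1 hi).le (sq_nonneg _)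
  · have hk' : ¬ hA.eigenvalues k ≤ E := fun h => hk (hv k h)
    exact mul_lt_mul_of_pos_right (not_le.1 hk') (sq_pos_iff.2 hk)

/-- Min-max, upper bound on the counting function: if the form exceeds `E` on a subspace, then at
least as many eigenvalues as its dimension exceed `E`. -/
theorem finrank_add_card_eigenvalues_le (hA : A.IsHermitian) {V : Type*} [AddCommGroup V]
    [Module ℝ V] [FiniteDimensional ℝ V] (f : V →ₗ[ℝ] (n → ℝ)) (E : ℝ)
    (h : ∀ v, v ≠ 0 → E * (f v ⬝ᵥ f v) < f v ⬝ᵥ A.mulVec (f v)) :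
    Module.finrank ℝ V + Nat.card {k // hA.eigenvalues k ≤ E} ≤ Fintype.card n := by
  by_contra! hlt
  rw [← card_add_card_not fun k => hA.eigenvalues k ≤ E] at hlt
  obtain ⟨v, hv0, hv⟩ := exists_eigenCoord_eq_zero hA f (fun k => ¬ hA.eigenvalues k ≤ E) (by omega)
  have h1 := h v hv0
  rw [dotProduct_mulVec_eq_sum hA, dotProduct_self_eq_sum hA, Finset.mul_sum] at h1
  refine absurd h1 (not_lt.2 (Finset.sum_le_sum fun i _ => ?_))
  by_cases hi : hA.eigenvalues i ≤ E
  · exact mul_le_mul_of_nonneg_right hi (sq_nonneg _)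
  · simp [hv i hi]

/-- The span of the eigenvectors selected by `p`, as an injective linear map. -/
def eigenSpan (hA : A.IsHermitian) (p : n → Prop) : ({k // p k} → ℝ) →ₗ[ℝ] (n → ℝ) :=
  (eigenCoord hA).symm.toLinearMap ∘ₗ Function.ExtendByZero.linearMap ℝ Subtype.val

theorem eigenCoord_eigenSpan (hA : A.IsHermitian) (p : n → Prop) (v : {k // p k} → ℝ) :
    eigenCoord hA (eigenSpan hA p v) = Function.extend Subtype.val v 0 := by
  simp only [eigenSpan, LinearMap.comp_apply, LinearEquiv.coe_coe, LinearEquiv.apply_symm_apply]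
  rfl

theorem eigenSpan_injective (hA : A.IsHermitian) (p : n → Prop) :
    Function.Injective (eigenSpan hA p) := by
  intro v w h
  have := congrArg (eigenCoord hA) h
  rw [eigenCoord_eigenSpan, eigenCoord_eigenSpan] at this
  exact Function.extend_injective Subtype.val_injective (0 : n → ℝ) this

theorem eigenCoord_eigenSpan_of_not (hA : A.IsHermitian) (p : n → Prop) (v : {k // p k} → ℝ)
    {k : n} (hk : ¬ p k) : eigenCoord hA (eigenSpan hA p v) k = 0 := by
  rw [eigenCoord_eigenSpan, Function.extend_apply' _ _ _ (by rintro ⟨a, rfl⟩; exact hk a.2)]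
  rfl

theorem eigenSpan_form_le (hA : A.IsHermitian) (E : ℝ) (v : {k // hA.eigenvalues k ≤ E} → ℝ) :
    eigenSpan hA (fun k => hA.eigenvalues k ≤ E) v ⬝ᵥ
        A.mulVec (eigenSpan hA (fun k => hA.eigenvalues k ≤ E) v)
      ≤ E * (eigenSpan hA (fun k => hA.eigenvalues k ≤ E) v ⬝ᵥ
        eigenSpan hA (fun k => hA.eigenvalues k ≤ E) v) := by
  rw [dotProduct_mulVec_eq_sum hA, dotProduct_self_eq_sum hA, Finset.mul_sum]
  refine Finset.sum_le_sum fun i _ => ?_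
  by_cases hi : hA.eigenvalues i ≤ E
  · exact mul_le_mul_of_nonneg_right hi (sq_nonneg _)
  · simp [eigenCoord_eigenSpan_of_not hA (fun k => hA.eigenvalues k ≤ E) v hi]

theorem le_eigenSpan_form (hA : A.IsHermitian) (E : ℝ) (v : {k // ¬ hA.eigenvalues k ≤ E} → ℝ) :
    E * (eigenSpan hA (fun k => ¬ hA.eigenvalues k ≤ E) v ⬝ᵥ
        eigenSpan hA (fun k => ¬ hA.eigenvalues k ≤ E) v)
      ≤ eigenSpan hA (fun k => ¬ hA.eigenvalues k ≤ E) v ⬝ᵥ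
        A.mulVec (eigenSpan hA (fun k => ¬ hA.eigenvalues k ≤ E) v) := by
  rw [dotProduct_mulVec_eq_sum hA, dotProduct_self_eq_sum hA, Finset.mul_sum]
  refine Finset.sum_le_sum fun i _ => ?_
  by_cases hi : hA.eigenvalues i ≤ E
  · simp [eigenCoord_eigenSpan_of_not hA (fun k => ¬ hA.eigenvalues k ≤ E) v (not_not.2 hi)]
  · exact mul_le_mul_of_nonneg_right (not_le.1 hi).le (sq_nonneg _)

/-- An approximate eigenvector with error `δ` forces an eigenvalue within `δ`. -/
theorem exists_eigenvalue_near (hA : A.IsHermitian) (E δ : ℝ) (hδ : 0 ≤ δ) (x : n → ℝ) (hx : x ≠ 0)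
    (h : (A.mulVec x - E • x) ⬝ᵥ (A.mulVec x - E • x) ≤ δ ^ 2 * (x ⬝ᵥ x)) :
    ∃ k, |hA.eigenvalues k - E| ≤ δ := by
  by_contra! hfar
  have hne : eigenCoord hA x ≠ 0 := by rwa [Ne, LinearEquiv.map_eq_zero_iff]
  obtain ⟨k, hk⟩ := Function.ne_iff.1 hne
  have hcoord : ∀ i, eigenCoord hA (A.mulVec x - E • x) i
      = (hA.eigenvalues i - E) * eigenCoord hA x i := fun i => by
    rw [map_sub, map_smul, Pi.sub_apply, eigenCoord_mulVec, Pi.smul_apply, smul_eq_mul]; ring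
  have hlt : ∀ i, δ ^ 2 < (hA.eigenvalues i - E) ^ 2 := fun i => by
    rw [← sq_abs (hA.eigenvalues i - E)]
    exact pow_lt_pow_left₀ (hfar i) hδ two_ne_zero
  rw [dotProduct_self_eq_sum hA, dotProduct_self_eq_sum hA, Finset.mul_sum] at h
  refine absurd h (not_le.2 (Finset.sum_lt_sum (fun i _ => ?_) ⟨k, Finset.mem_univ _, ?_⟩))
  · rw [hcoord, mul_pow]
    exact mul_le_mul_of_nonneg_right (hlt i).le (sq_nonneg _)
  · rw [hcoord, mul_pow]
    have : 0 < eigenCoord hA x k ^ 2 := sq_pos_iff.2 hk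
    exact mul_lt_mul_of_pos_right (hlt k) this

end EigenvalueCounting

/-! ### The potential in terms of cells -/

theorem potential_odd (lam : ℝ) (ω : Config) (k : ℤ) :
    potential lam ω (2 * k + 1) = if ω k = 0 then lam else 0 := by
  rw [potential_eq]
  have h : (2 * k + 1 - 1) / 2 = k := by omega
  rw [h]
  have := (ω k).isLt
  congr 1
  rw [← Fin.val_eq_zero_iff, eq_iff_iff]
  omega

theorem potential_even (lam : ℝ) (ω : Config) (k : ℤ) :
    potential lam ω (2 * k + 2) = if ω k = 0 then 0 else lam := by
  rw [potential_eq]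
  have h : (2 * k + 2 - 1) / 2 = k := by omega
  rw [h, ← ite_not]
  have := (ω k).isLt
  congr 1
  rw [← Fin.val_eq_zero_iff, eq_iff_iff]
  omega

/-- The configuration with every displacement reversed. -/
def flip (ω : Config) : Config := fun k => if ω k = 0 then 1 else 0

theorem potential_flip (lam : ℝ) (ω : Config) (n : ℤ) :
    potential lam (flip ω) n = lam - potential lam ω n := by
  obtain ⟨k, rfl | rfl⟩ : ∃ k, n = 2 * k + 1 ∨ n = 2 * k + 2 := ⟨(n - 1) / 2, by omega⟩
  · rw [potential_odd, potential_odd]; unfold flip; by_cases h : ω k = 0 <;> simp [h]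
  · rw [potential_even, potential_even]; unfold flip; by_cases h : ω k = 0 <;> simp [h]

theorem flip_flip (ω : Config) : flip (flip ω) = ω := by
  funext k
  unfold flip
  rcases Fin.exists_fin_two.1 ⟨ω k, rfl⟩ with h | h <;> simp [h]

/-- The configuration seen from the cell `j`. -/
def shiftConfig (j : ℤ) (ω : Config) : Config := fun k => ω (k + j)

theorem potential_shiftConfig (lam : ℝ) (ω : Config) (j n : ℤ) :
    potential lam (shiftConfig j ω) n = potential lam ω (n + 2 * j) := by
  obtain ⟨k, rfl | rfl⟩ : ∃ k, n = 2 * k + 1 ∨ n = 2 * k + 2 := ⟨(n - 1) / 2, by omega⟩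
  · rw [potential_odd, show 2 * k + 1 + 2 * j = 2 * (k + j) + 1 by ring, potential_odd]; rfl
  · rw [potential_even, show 2 * k + 2 + 2 * j = 2 * (k + j) + 2 by ring, potential_even]; rfl

/-! ### The quadratic form of a box -/

/-- The values on the sites `1, …, 2L` of a sequence on `ℕ`. -/
def boxRestrict (L : ℕ) : (ℕ → ℝ) →ₗ[ℝ] (Fin (2 * L) → ℝ) :=
  LinearMap.funLeft ℝ ℝ fun i : Fin (2 * L) => (i : ℕ) + 1

theorem boxRestrict_apply (L : ℕ) (X : ℕ → ℝ) (i : Fin (2 * L)) :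
    boxRestrict L X i = X ((i : ℕ) + 1) := rfl

/-- The extension by zero of a vector on the sites `1, …, 2L` to a sequence on `ℕ`. -/
def zeroExtend (L : ℕ) : (Fin (2 * L) → ℝ) →ₗ[ℝ] (ℕ → ℝ) where
  toFun x i := if h : i - 1 < 2 * L ∧ i ≠ 0 then x ⟨i - 1, h.1⟩ else 0
  map_add' x y := by
    funext i
    by_cases h : i - 1 < 2 * L ∧ i ≠ 0 <;> simp [h]
  map_smul' c x := by
    funext i
    by_cases h : i - 1 < 2 * L ∧ i ≠ 0 <;> simp [h]

theorem zeroExtend_apply (L : ℕ) (x : Fin (2 * L) → ℝ) (i : ℕ) :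
    zeroExtend L x i = if h : i - 1 < 2 * L ∧ i ≠ 0 then x ⟨i - 1, h.1⟩ else 0 := rfl

@[simp] theorem zeroExtend_zero (L : ℕ) (x : Fin (2 * L) → ℝ) : zeroExtend L x 0 = 0 := by
  simp [zeroExtend_apply]

theorem zeroExtend_of_lt (L : ℕ) (x : Fin (2 * L) → ℝ) {i : ℕ} (hi : 2 * L < i) :
    zeroExtend L x i = 0 := by
  rw [zeroExtend_apply, dif_neg (by omega)]

@[simp] theorem boxRestrict_zeroExtend (L : ℕ) (x : Fin (2 * L) → ℝ) :
    boxRestrict L (zeroExtend L x) = x := by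
  funext i
  rw [boxRestrict_apply, zeroExtend_apply, dif_pos ⟨by omega, by omega⟩]
  rfl

/-- The squared norm of a sequence on the sites `1, …, 2L`, summed over cells. -/
def boxNormSq (L : ℕ) (X : ℕ → ℝ) : ℝ :=
  ∑ k ∈ Finset.range L, (X (2 * k + 1) ^ 2 + X (2 * k + 2) ^ 2)

/-- The quadratic form of `boxMatrix`, as a function of a sequence `X` that vanishes at `0`. -/
def boxForm (lam a b : ℝ) (ω : Config) (L : ℕ) (X : ℕ → ℝ) : ℝ :=
  ∑ k ∈ Finset.range L, (potential lam ω (2 * k + 1) * X (2 * k + 1) ^ 2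
      + potential lam ω (2 * k + 2) * X (2 * k + 2) ^ 2
      - 2 * X (2 * k) * X (2 * k + 1) - 2 * X (2 * k + 1) * X (2 * k + 2))
    + a * X 1 ^ 2 + b * X (2 * L) ^ 2

theorem sum_range_two_mul (g : ℕ → ℝ) (L : ℕ) :
    ∑ i ∈ Finset.range (2 * L), g i = ∑ k ∈ Finset.range L, (g (2 * k) + g (2 * k + 1)) := by
  induction L with
  | zero => simp
  | succ L ih =>
    rw [Nat.mul_succ, Finset.sum_range_succ, Finset.sum_range_succ, Finset.sum_range_succ, ih]
    ring

theorem boxRestrict_dotProduct_self (L : ℕ) (X : ℕ → ℝ) :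
    boxRestrict L X ⬝ᵥ boxRestrict L X = boxNormSq L X := by
  simp only [dotProduct, boxRestrict_apply]
  rw [Fin.sum_univ_eq_sum_range (fun i => X (i + 1) * X (i + 1)) (2 * L), sum_range_two_mul]
  exact Finset.sum_congr rfl fun k _ => by ring

theorem boxMatrix_mulVec (lam a b : ℝ) (ω : Config) (L : ℕ) (X : ℕ → ℝ) (i : Fin (2 * L)) :
    (boxMatrix lam a b ω L).mulVec (boxRestrict L X) i
      = (potential lam ω ((i : ℕ) + 1 : ℤ) + (if (i : ℕ) = 0 then a else 0)
          + (if (i : ℕ) + 1 = 2 * L then b else 0)) * X (i + 1)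
        - (if (i : ℕ) = 0 then 0 else X i) - (if (i : ℕ) + 1 = 2 * L then 0 else X (i + 2)) := by
  obtain ⟨i, hi⟩ := i
  set D := potential lam ω (i + 1 : ℤ) + (if i = 0 then a else 0)
          + (if i + 1 = 2 * L then b else 0) with hD
  have h1 : (boxMatrix lam a b ω L).mulVec (boxRestrict L X) ⟨i, hi⟩
      = ∑ j ∈ Finset.range (2 * L), ((if i = j then D * X (j + 1) else 0)
        - (if j + 1 = i then X (j + 1) else 0) - (if i + 1 = j then X (j + 1) else 0)) := by
    rw [← Fin.sum_univ_eq_sum_range (fun j : ℕ => (if i = j then D * X (j + 1) else 0)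
        - (if j + 1 = i then X (j + 1) else 0) - (if i + 1 = j then X (j + 1) else 0)) (2 * L),
      Matrix.mulVec, dotProduct]
    refine Finset.sum_congr rfl fun j _ => ?_
    simp only [boxMatrix, Matrix.of_apply, boxRestrict_apply, Fin.ext_iff, ← hD]
    by_cases h1 : i = j
    · simp [h1]
    · by_cases h2 : i + 1 = j
      · have h3 : ¬ (j : ℕ) + 1 = i := by omega
        simp [h1, h2, h3]
      · by_cases h3 : (j : ℕ) + 1 = i <;> simp [h1, h2, h3]
  rw [h1, Finset.sum_sub_distrib, Finset.sum_sub_distrib, Finset.sum_ite_eq, Finset.sum_ite_eq,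
    if_pos (Finset.mem_range.2 hi)]
  congr 1
  · congr 1
    rcases i with _ | i
    · simp
    · simp only [Nat.add_right_cancel_iff, Nat.succ_ne_zero, if_false]
      rw [Finset.sum_ite_eq', if_pos (Finset.mem_range.2 (by omega))]
  · by_cases h : i + 1 = 2 * L
    · rw [if_pos h, if_neg (by simp; omega)]
    · rw [if_neg h, if_pos (by simp; omega)]

theorem boxRestrict_form (lam a b : ℝ) (ω : Config) {L : ℕ} (hL : 0 < L) (X : ℕ → ℝ)
    (hX : X 0 = 0) :
    boxRestrict L X ⬝ᵥ (boxMatrix lam a b ω L).mulVec (boxRestrict L X)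
      = boxForm lam a b ω L X := by
  have h1 : boxRestrict L X ⬝ᵥ (boxMatrix lam a b ω L).mulVec (boxRestrict L X)
      = ∑ i ∈ Finset.range (2 * L), (potential lam ω (i + 1 : ℤ) * X (i + 1) ^ 2
        + (if i = 0 then a * X (i + 1) ^ 2 else 0)
        + (if i + 1 = 2 * L then b * X (i + 1) ^ 2 else 0) - X i * X (i + 1)
        - (if i + 1 = 2 * L then 0 else X (i + 1) * X (i + 2))) := by
    rw [dotProduct, ← Fin.sum_univ_eq_sum_range (fun i : ℕ =>
        potential lam ω (i + 1 : ℤ) * X (i + 1) ^ 2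
        + (if i = 0 then a * X (i + 1) ^ 2 else 0)
        + (if i + 1 = 2 * L then b * X (i + 1) ^ 2 else 0) - X i * X (i + 1)
        - (if i + 1 = 2 * L then 0 else X (i + 1) * X (i + 2)))]
    refine Finset.sum_congr rfl fun i _ => ?_
    rw [boxMatrix_mulVec, boxRestrict_apply]
    by_cases h0 : (i : ℕ) = 0
    · by_cases h2 : (i : ℕ) + 1 = 2 * L
      · omega
      · rw [if_pos h0, if_neg h2, if_pos h0, if_neg h2, if_pos h0, if_neg h2, if_neg h2, h0, hX]
        ring
    · by_cases h2 : (i : ℕ) + 1 = 2 * L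
      · simp only [h0, h2, if_true, if_false]; ring
      · simp only [h0, h2, if_false]; ring
  have h2 : ∀ n : ℕ, 0 < n →
      ∑ i ∈ Finset.range n, (if i + 1 = n then 0 else X (i + 1) * X (i + 2))
        = ∑ i ∈ Finset.range n, X i * X (i + 1) := by
    rintro (_ | m) hm
    · omega
    · rw [Finset.sum_range_succ, Finset.sum_range_succ', hX, if_pos rfl, zero_mul]
      congr 1
      refine Finset.sum_congr rfl fun i hi => ?_
      rw [if_neg (by have := Finset.mem_range.1 hi; omega)]
  have h3 : ∑ i ∈ Finset.range (2 * L), (if i + 1 = 2 * L then b * X (i + 1) ^ 2 else 0)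
      = b * X (2 * L) ^ 2 := by
    rw [Finset.sum_eq_single_of_mem (2 * L - 1) (Finset.mem_range.2 (by omega))]
    · rw [if_pos (by omega), show 2 * L - 1 + 1 = 2 * L by omega]
    · intro i _ hi
      rw [if_neg (by omega)]
  rw [h1, Finset.sum_sub_distrib, Finset.sum_sub_distrib, Finset.sum_add_distrib,
    Finset.sum_add_distrib, h2 _ (by omega), h3, Finset.sum_ite_eq' (Finset.range (2 * L)) 0,
    if_pos (Finset.mem_range.2 (by omega)), sum_range_two_mul, sum_range_two_mul, boxForm]
  simp only [Finset.sum_sub_distrib, Finset.sum_add_distrib, mul_assoc, ← Finset.mul_sum]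
  push_cast
  simp only [add_assoc]
  norm_num
  ring

/-- Sequences on which the form of the box is at most `E` bound the counting function below. -/
theorem finrank_le_eigCount {lam a b : ℝ} {ω : Config} {L : ℕ} (hL : 0 < L) {V : Type*}
    [AddCommGroup V] [Module ℝ V] [FiniteDimensional ℝ V] (F : V →ₗ[ℝ] (ℕ → ℝ)) (E : ℝ)
    (h0 : ∀ v, F v 0 = 0) (hinj : ∀ v, boxRestrict L (F v) = 0 → v = 0)
    (h : ∀ v, boxForm lam a b ω L (F v) ≤ E * boxNormSq L (F v)) :
    Module.finrank ℝ V ≤ eigCount lam a b ω L E := by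
  refine finrank_le_card_eigenvalues_le (boxMatrix_isHermitian lam a b ω L) (boxRestrict L ∘ₗ F)
    ((injective_iff_map_eq_zero _).2 hinj) E fun v => ?_
  rw [LinearMap.comp_apply, boxRestrict_form lam a b ω hL _ (h0 v), boxRestrict_dotProduct_self]
  exact h v

/-- Sequences on which the form of the box exceeds `E` bound the counting function above. -/
theorem finrank_add_eigCount_le {lam a b : ℝ} {ω : Config} {L : ℕ} (hL : 0 < L) {V : Type*}
    [AddCommGroup V] [Module ℝ V] [FiniteDimensional ℝ V] (F : V →ₗ[ℝ] (ℕ → ℝ)) (E : ℝ)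
    (h0 : ∀ v, F v 0 = 0)
    (h : ∀ v, v ≠ 0 → E * boxNormSq L (F v) < boxForm lam a b ω L (F v)) :
    Module.finrank ℝ V + eigCount lam a b ω L E ≤ 2 * L := by
  have := finrank_add_card_eigenvalues_le (boxMatrix_isHermitian lam a b ω L)
    (boxRestrict L ∘ₗ F) E fun v hv => ?_
  · rwa [Fintype.card_fin] at this
  rw [LinearMap.comp_apply, boxRestrict_form lam a b ω hL _ (h0 v), boxRestrict_dotProduct_self]
  exact h v hv

theorem exists_sequences_le {lam a b : ℝ} (ω : Config) {L : ℕ} (hL : 0 < L) (E : ℝ) :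
    ∃ F : (Fin (eigCount lam a b ω L E) → ℝ) →ₗ[ℝ] (Fin (2 * L) → ℝ), Function.Injective F ∧
      ∀ v, boxForm lam a b ω L (zeroExtend L (F v)) ≤ E * boxNormSq L (zeroExtend L (F v)) := by
  set hA := boxMatrix_isHermitian lam a b ω L
  have e : Fin (eigCount lam a b ω L E) ≃ {k // hA.eigenvalues k ≤ E} :=
    (Finite.equivFinOfCardEq rfl).symm
  refine ⟨eigenSpan hA _ ∘ₗ (LinearEquiv.funCongrLeft ℝ ℝ e.symm).toLinearMap,
    (eigenSpan_injective hA _).comp (LinearEquiv.injective _), fun v => ?_⟩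
  rw [← boxRestrict_form lam a b ω hL _ (zeroExtend_zero _ _), ← boxRestrict_dotProduct_self,
    boxRestrict_zeroExtend]
  exact eigenSpan_form_le hA E _

theorem exists_sequences_ge {lam a b : ℝ} (ω : Config) {L : ℕ} (hL : 0 < L) (E : ℝ) :
    ∃ F : (Fin (2 * L - eigCount lam a b ω L E) → ℝ) →ₗ[ℝ] (Fin (2 * L) → ℝ),
      Function.Injective F ∧
      ∀ v, E * boxNormSq L (zeroExtend L (F v)) ≤ boxForm lam a b ω L (zeroExtend L (F v)) := by
  set hA := boxMatrix_isHermitian lam a b ω L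
  have hcard : Nat.card {k // ¬ hA.eigenvalues k ≤ E} = 2 * L - eigCount lam a b ω L E := by
    have := card_add_card_not fun k => hA.eigenvalues k ≤ E
    rw [Fintype.card_fin] at this
    unfold eigCount
    omega
  have e : Fin (2 * L - eigCount lam a b ω L E) ≃ {k // ¬ hA.eigenvalues k ≤ E} :=
    (Finite.equivFinOfCardEq hcard).symm
  refine ⟨eigenSpan hA _ ∘ₗ (LinearEquiv.funCongrLeft ℝ ℝ e.symm).toLinearMap,
    (eigenSpan_injective hA _).comp (LinearEquiv.injective _), fun v => ?_⟩
  rw [← boxRestrict_form lam a b ω hL _ (zeroExtend_zero _ _), ← boxRestrict_dotProduct_self,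
    boxRestrict_zeroExtend]
  exact le_eigenSpan_form hA E _

theorem eigCount_le (lam a b : ℝ) (ω : Config) (L : ℕ) (E : ℝ) :
    eigCount lam a b ω L E ≤ 2 * L := by
  have := card_add_card_not fun k => (boxMatrix_isHermitian lam a b ω L).eigenvalues k ≤ E
  rw [Fintype.card_fin] at this
  unfold eigCount
  omega

theorem eigCount_mono (lam a b : ℝ) (ω : Config) (L : ℕ) : Monotone (eigCount lam a b ω L) :=
  fun _ _ hEE => Nat.card_le_card_of_injective (fun k => ⟨k.1, k.2.trans hEE⟩)
    fun _ _ h => Subtype.ext (congrArg (fun k => k.1) h)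

/-- Changing the boundary conditions moves the counting function by at most `2`: the forms agree on
the vectors that vanish at both ends of the box. -/
theorem eigCount_le_add_two (lam a b a' b' : ℝ) (ω : Config) (L : ℕ) (E : ℝ) :
    eigCount lam a b ω L E ≤ eigCount lam a' b' ω L E + 2 := by
  rcases Nat.eq_zero_or_pos L with rfl | hL
  · have := eigCount_le lam a b ω 0 E
    omega
  obtain ⟨F, hF, hform⟩ := exists_sequences_le (lam := lam) (a := a) (b := b) ω hL E
  let ends : (Fin (eigCount lam a b ω L E) → ℝ) →ₗ[ℝ] ℝ × ℝ :=
    ((LinearMap.proj 1).prod (LinearMap.proj (2 * L))) ∘ₗ zeroExtend L ∘ₗ F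
  have hends : ∀ v : LinearMap.ker ends, zeroExtend L (F v) 1 = 0 ∧
      zeroExtend L (F v) (2 * L) = 0 := fun v => by
    have := LinearMap.mem_ker.1 v.2
    exact ⟨congrArg Prod.fst this, congrArg Prod.snd this⟩
  have hker : eigCount lam a b ω L E ≤ Module.finrank ℝ (LinearMap.ker ends) + 2 := by
    have h1 := LinearMap.finrank_range_add_finrank_ker ends
    have h2 := (LinearMap.range ends).finrank_le
    simp only [Module.finrank_fin_fun, Module.finrank_prod, Module.finrank_self] at h1 h2
    omega
  refine hker.trans (Nat.add_le_add_right ?_ 2)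
  refine finrank_le_eigCount hL (zeroExtend L ∘ₗ F ∘ₗ (LinearMap.ker ends).subtype) E
    (fun v => zeroExtend_zero _ _) (fun v hv => ?_) fun v => ?_
  · have h1 : F v = 0 := by simpa using hv
    exact Subtype.ext (hF (h1.trans (map_zero F).symm))
  · have h1 := hform v
    obtain ⟨h2, h3⟩ := hends v
    simp only [boxForm, h2, h3, LinearMap.comp_apply, Submodule.subtype_apply] at h1 ⊢
    linarith

/-! ### Superadditivity and the reflection symmetry of the counting function -/

theorem eigCount_zero (lam a b : ℝ) (ω : Config) (E : ℝ) : eigCount lam a b ω 0 E = 0 := by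
  have := eigCount_le lam a b ω 0 E
  omega

/-- Cutting the bond between two boxes with the boundary condition `1` raises the form by
`(X (2L) + X (2L + 1)) ^ 2`. -/
theorem boxForm_add_le (lam : ℝ) (ω : Config) {L M : ℕ} (hM : 0 < M) (X Y : ℕ → ℝ)
    (hY : Y 0 = 0) (hXY : ∀ i, 0 < i → Y i = X (2 * L + i)) :
    boxForm lam 1 1 ω (L + M) X
      ≤ boxForm lam 1 1 ω L X + boxForm lam 1 1 (shiftConfig L ω) M Y := by
  obtain ⟨M, rfl⟩ : ∃ m, M = m + 1 := ⟨M - 1, by omega⟩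
  have h1 : ∀ k : ℕ, potential lam ω (2 * ((L + k : ℕ) : ℤ) + 1)
      = potential lam (shiftConfig L ω) (2 * k + 1) := fun k => by
    rw [potential_shiftConfig]; congr 1; push_cast; ring
  have h2 : ∀ k : ℕ, potential lam ω (2 * ((L + k : ℕ) : ℤ) + 2)
      = potential lam (shiftConfig L ω) (2 * k + 2) := fun k => by
    rw [potential_shiftConfig]; congr 1; push_cast; ring
  have h3 : ∑ k ∈ Finset.range (M + 1),
        (potential lam ω (2 * ((L + k : ℕ) : ℤ) + 1) * X (2 * (L + k) + 1) ^ 2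
      + potential lam ω (2 * ((L + k : ℕ) : ℤ) + 2) * X (2 * (L + k) + 2) ^ 2
      - 2 * X (2 * (L + k)) * X (2 * (L + k) + 1) - 2 * X (2 * (L + k) + 1) * X (2 * (L + k) + 2))
      = ∑ k ∈ Finset.range (M + 1),
        (potential lam (shiftConfig L ω) (2 * k + 1) * Y (2 * k + 1) ^ 2
      + potential lam (shiftConfig L ω) (2 * k + 2) * Y (2 * k + 2) ^ 2
      - 2 * Y (2 * k) * Y (2 * k + 1) - 2 * Y (2 * k + 1) * Y (2 * k + 2))
      - 2 * X (2 * L) * X (2 * L + 1) := by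
    rw [Finset.sum_range_succ', Finset.sum_range_succ']
    have hx0 : ∀ k, X (2 * (L + (k + 1))) = Y (2 * (k + 1)) := fun k => by
      rw [hXY _ (by omega), mul_add 2 L]
    have hx1 : ∀ k, X (2 * (L + k) + 1) = Y (2 * k + 1) := fun k => by
      rw [hXY _ (by omega), mul_add 2 L, add_assoc]
    have hx2 : ∀ k, X (2 * (L + k) + 2) = Y (2 * k + 2) := fun k => by
      rw [hXY _ (by omega), mul_add 2 L, add_assoc]
    simp only [h1, h2, hx0, hx1, hx2]
    rw [← hXY 1 one_pos, mul_zero, hY, add_zero, zero_add]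
    ring
  simp only [boxForm]
  rw [Finset.sum_range_add _ L, h3, hXY 1 one_pos, hXY (2 * (M + 1)) (by omega),
    mul_add 2 L (M + 1)]
  linarith [sq_nonneg (X (2 * L) + X (2 * L + 1)), add_sq (X (2 * L)) (X (2 * L + 1))]

theorem boxNormSq_add (L M : ℕ) (X : ℕ → ℝ) :
    boxNormSq (L + M) X = boxNormSq L X + boxNormSq M fun i => X (2 * L + i) := by
  simp only [boxNormSq, Finset.sum_range_add, mul_add, add_assoc]

theorem boxForm_congr (lam a b : ℝ) (ω : Config) {L : ℕ} (hL : 0 < L) {X Y : ℕ → ℝ}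
    (h : ∀ i ≤ 2 * L, X i = Y i) : boxForm lam a b ω L X = boxForm lam a b ω L Y := by
  unfold boxForm
  rw [h 1 (by omega), h (2 * L) le_rfl]
  congr 2
  refine Finset.sum_congr rfl fun k hk => ?_
  have := Finset.mem_range.1 hk
  rw [h _ (by omega), h _ (by omega), h _ (by omega)]

theorem boxNormSq_congr (L : ℕ) {X Y : ℕ → ℝ} (h : ∀ i, 0 < i → i ≤ 2 * L → X i = Y i) :
    boxNormSq L X = boxNormSq L Y := by
  refine Finset.sum_congr rfl fun k hk => ?_
  have := Finset.mem_range.1 hk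
  rw [h _ (by omega) (by omega), h _ (by omega) (by omega)]

/-- With boundary conditions `1` the counting function is superadditive in the box. -/
theorem eigCount_add_le (lam : ℝ) (ω : Config) (L M : ℕ) (E : ℝ) :
    eigCount lam 1 1 ω L E + eigCount lam 1 1 (shiftConfig L ω) M E
      ≤ eigCount lam 1 1 ω (L + M) E := by
  rcases Nat.eq_zero_or_pos L with rfl | hL
  · rw [eigCount_zero, zero_add, zero_add]
    have : shiftConfig (0 : ℕ) ω = ω := by funext k; simp [shiftConfig]
    rw [this]
  rcases Nat.eq_zero_or_pos M with rfl | hM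
  · rw [eigCount_zero, add_zero, add_zero]
  obtain ⟨F, hF, hFform⟩ := exists_sequences_le (lam := lam) (a := 1) (b := 1) ω hL E
  obtain ⟨G, hG, hGform⟩ :=
    exists_sequences_le (lam := lam) (a := 1) (b := 1) (shiftConfig L ω) hM E
  let H := (zeroExtend L ∘ₗ F).coprod
    (LinearMap.funLeft ℝ ℝ (fun i : ℕ => i - 2 * L) ∘ₗ zeroExtend M ∘ₗ G)
  have hH : ∀ v i, H v i = zeroExtend L (F v.1) i + zeroExtend M (G v.2) (i - 2 * L) :=
    fun v i => rfl
  have hleft : ∀ v, ∀ i ≤ 2 * L, H v i = zeroExtend L (F v.1) i := fun v i hi => by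
    rw [hH, Nat.sub_eq_zero_of_le hi, zeroExtend_zero, add_zero]
  have hright : ∀ v, ∀ i, 0 < i → zeroExtend M (G v.2) i = H v (2 * L + i) := fun v i hi => by
    rw [hH, zeroExtend_of_lt L _ (by omega), zero_add, Nat.add_sub_cancel_left]
  have := finrank_le_eigCount (lam := lam) (a := 1) (b := 1) (ω := ω) (L := L + M)
    (by omega) H E (fun v => ?_) (fun v hv => ?_) (fun v => ?_)
  · simpa [Module.finrank_prod] using this
  · rw [hleft v 0 (Nat.zero_le _), zeroExtend_zero]
  · have hv' : ∀ i, 0 < i → i ≤ 2 * (L + M) → H v i = 0 := fun i h1 h2 => by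
      have := congrFun hv ⟨i - 1, by omega⟩
      rwa [boxRestrict_apply, show i - 1 + 1 = i by omega] at this
    refine Prod.ext (hF ?_) (hG ?_)
    · rw [Prod.fst_zero, map_zero, ← boxRestrict_zeroExtend L (F v.1)]
      funext i
      rw [boxRestrict_apply, ← hleft v _ (by omega)]
      exact hv' _ (by omega) (by omega)
    · rw [Prod.snd_zero, map_zero, ← boxRestrict_zeroExtend M (G v.2)]
      funext i
      rw [boxRestrict_apply, hright v _ (by omega)]
      exact hv' _ (by omega) (by omega)
  · refine (boxForm_add_le lam ω hM (H v) (zeroExtend M (G v.2)) (zeroExtend_zero _ _)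
      (hright v)).trans ?_
    rw [boxNormSq_add, mul_add, boxForm_congr lam 1 1 ω hL (hleft v),
      boxNormSq_congr L fun i _ => hleft v i, ← boxNormSq_congr M fun i hi _ => hright v i hi]
    exact add_le_add (hFform _) (hGform _)

/-- Multiplication of a sequence by `(-1) ^ i`. -/
def alternate : (ℕ → ℝ) →ₗ[ℝ] (ℕ → ℝ) where
  toFun X i := (-1) ^ i * X i
  map_add' X Y := by funext i; exact mul_add _ _ _
  map_smul' c X := by funext i; exact mul_left_comm _ _ _

theorem alternate_apply (X : ℕ → ℝ) (i : ℕ) : alternate X i = (-1) ^ i * X i := rfl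

theorem neg_one_pow_two_mul (k : ℕ) : (-1 : ℝ) ^ (2 * k) = 1 := by rw [pow_mul]; simp

theorem boxNormSq_alternate (L : ℕ) (X : ℕ → ℝ) : boxNormSq L (alternate X) = boxNormSq L X := by
  refine Finset.sum_congr rfl fun k _ => ?_
  simp only [alternate_apply, pow_add, neg_one_pow_two_mul]; ring

theorem boxForm_alternate (lam a b : ℝ) (ω : Config) (L : ℕ) (X : ℕ → ℝ) :
    boxForm lam a b ω L (alternate X)
      = lam * boxNormSq L X - boxForm lam (-a) (-b) (flip ω) L X := by
  simp only [boxForm, boxNormSq, alternate_apply, pow_add, neg_one_pow_two_mul, potential_flip,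
    Finset.mul_sum]
  rw [sub_add_eq_sub_sub, sub_add_eq_sub_sub, ← Finset.sum_sub_distrib]
  simp only [pow_one, one_mul, neg_mul, neg_sq, sub_neg_eq_add]
  congr 2
  refine Finset.sum_congr rfl fun k _ => ?_
  ring

theorem boxRestrict_alternate_zeroExtend {L : ℕ} {x : Fin (2 * L) → ℝ}
    (h : boxRestrict L (alternate (zeroExtend L x)) = 0) : x = 0 := by
  rw [← boxRestrict_zeroExtend L x]
  funext i
  have := congrFun h i
  simpa [boxRestrict_apply, alternate_apply] using this

/-- The reflection `E ↦ lam - E` exchanges the eigenvalues `≤ E` and `≥ lam - E`. -/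
theorem two_mul_le_eigCount_add (lam a b : ℝ) (ω : Config) (L : ℕ) (E : ℝ) :
    2 * L ≤ eigCount lam a b ω L E + eigCount lam (-a) (-b) (flip ω) L (lam - E) := by
  rcases Nat.eq_zero_or_pos L with rfl | hL
  · omega
  obtain ⟨F, hF, hform⟩ := exists_sequences_ge (lam := lam) (a := a) (b := b) ω hL E
  have := finrank_le_eigCount (lam := lam) (a := -a) (b := -b) (ω := flip ω) hL
    (alternate ∘ₗ zeroExtend L ∘ₗ F) (lam - E) (fun v => by simp [alternate_apply])
    (fun v hv => hF ((boxRestrict_alternate_zeroExtend hv).trans (map_zero F).symm)) fun v => ?_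
  · rw [Module.finrank_fin_fun] at this
    omega
  · simp only [LinearMap.comp_apply]
    rw [boxForm_alternate, boxNormSq_alternate, neg_neg, neg_neg, flip_flip]
    linarith [hform v]

theorem boxNormSq_pos {L : ℕ} {x : Fin (2 * L) → ℝ} (hx : x ≠ 0) :
    0 < boxNormSq L (zeroExtend L x) := by
  rw [← boxRestrict_dotProduct_self, boxRestrict_zeroExtend]
  refine lt_of_le_of_ne (Finset.sum_nonneg fun i _ => mul_self_nonneg _) fun h => hx ?_
  exact dotProduct_self_eq_zero.1 h.symm

theorem eigCount_add_le_two_mul (lam a b : ℝ) (ω : Config) (L : ℕ) {E E' : ℝ} (hE : E + E' < lam) :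
    eigCount lam a b ω L E + eigCount lam (-a) (-b) (flip ω) L E' ≤ 2 * L := by
  rcases Nat.eq_zero_or_pos L with rfl | hL
  · rw [eigCount_zero, eigCount_zero]
  obtain ⟨F, hF, hform⟩ := exists_sequences_le (lam := lam) (a := -a) (b := -b) (flip ω) hL E'
  have := finrank_add_eigCount_le (lam := lam) (a := a) (b := b) (ω := ω) hL
    (alternate ∘ₗ zeroExtend L ∘ₗ F) E (fun v => by simp [alternate_apply]) fun v hv => ?_
  · rw [Module.finrank_fin_fun] at this
    omega
  · simp only [LinearMap.comp_apply]
    rw [boxForm_alternate, boxNormSq_alternate]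
    have h1 : F v ≠ 0 := fun h => hv (hF (h.trans (map_zero F).symm))
    nlinarith [hform v, boxNormSq_pos h1]

/-! ### The forms at the band edges -/

/-- The deviation of a pair of values in the cell `k` from the eigenvectors of that cell. -/
def cellDev (c : ℝ) (ω : Config) (k : ℕ) (X : ℕ → ℝ) : ℝ :=
  if ω k = 0 then X (2 * k + 1) - c * X (2 * k + 2) else c * X (2 * k + 1) - X (2 * k + 2)

/-- The splitting of the form into cells and bonds at the energy `-1 - c`. -/
theorem boxForm_sub_eq {lam c : ℝ} (hc : c ^ 2 + lam * c = 1) (ω : Config) (L : ℕ) (X : ℕ → ℝ) :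
    boxForm lam 0 0 ω L X - (-1 - c) * boxNormSq L X + X 0 ^ 2
      = ∑ k ∈ Finset.range L, cellDev c ω k X ^ 2 / c
        + ∑ k ∈ Finset.range L, (X (2 * k) - X (2 * k + 1)) ^ 2 + X (2 * L) ^ 2 := by
  have hc0 : c ≠ 0 := by rintro rfl; simp at hc
  induction L with
  | zero => simp [boxForm, boxNormSq]
  | succ L ih =>
    have hcell : potential lam ω (2 * L + 1) * X (2 * L + 1) ^ 2
        + potential lam ω (2 * L + 2) * X (2 * L + 2) ^ 2 - 2 * X (2 * L + 1) * X (2 * L + 2)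
        - (-1 - c) * (X (2 * L + 1) ^ 2 + X (2 * L + 2) ^ 2)
        = X (2 * L + 1) ^ 2 + X (2 * L + 2) ^ 2 + cellDev c ω L X ^ 2 / c := by
      rw [← sub_eq_iff_eq_add', eq_div_iff hc0, potential_odd, potential_even, cellDev]
      split_ifs
      · linear_combination X (2 * L + 1) ^ 2 * hc
      · linear_combination X (2 * L + 2) ^ 2 * hc
    simp only [boxForm, boxNormSq, Finset.sum_range_succ, mul_add, mul_one] at ih ⊢
    linear_combination ih + hcell

/-- Strict positivity at a band edge: the zero boundary condition costs `X (2L) ^ 2`, and a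
nonzero value propagates along cells and bonds. -/
theorem lt_boxForm {lam c : ℝ} (hc : c ^ 2 + lam * c = 1) (ω : Config) {L : ℕ}
    (X : ℕ → ℝ) (h0 : X 0 = 0) (hdev : 0 < c ∨ ∀ k < L, cellDev c ω k X = 0)
    (hX : ∃ i ≤ 2 * L, X i ≠ 0) : (-1 - c) * boxNormSq L X < boxForm lam 0 0 ω L X := by
  have hc0 : c ≠ 0 := by rintro rfl; simp at hc
  by_contra! hle
  have hsum := boxForm_sub_eq hc ω L X
  have hdevnn : ∀ k ∈ Finset.range L, 0 ≤ cellDev c ω k X ^ 2 / c := fun k hk => by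
    rcases hdev with h | h
    · positivity
    · simp [h k (Finset.mem_range.1 hk)]
  have hbnn : ∀ k ∈ Finset.range L, 0 ≤ (X (2 * k) - X (2 * k + 1)) ^ 2 := fun k _ => sq_nonneg _
  have h1 := Finset.sum_nonneg hdevnn
  have h2 := Finset.sum_nonneg hbnn
  have h3 := sq_nonneg (X (2 * L))
  rw [h0] at hsum
  have hd0 : ∀ k < L, cellDev c ω k X = 0 := fun k hk => by
    have := (Finset.sum_eq_zero_iff_of_nonneg hdevnn).1 (by linarith) k (Finset.mem_range.2 hk)
    simpa [hc0] using this
  have hb0 : ∀ k < L, X (2 * k) = X (2 * k + 1) := fun k hk => by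
    have := (Finset.sum_eq_zero_iff_of_nonneg hbnn).1 (by linarith) k (Finset.mem_range.2 hk)
    exact sub_eq_zero.1 (pow_eq_zero_iff two_ne_zero |>.1 this)
  have heven : ∀ k ≤ L, X (2 * k) = 0 := by
    intro k
    induction k with
    | zero => exact fun _ => h0
    | succ k ih =>
      intro hk
      have h4 := ih (by omega)
      have h5 := hd0 k (by omega)
      rw [cellDev, ← hb0 k (by omega), h4] at h5
      rw [mul_add, mul_one]
      split_ifs at h5
      · simpa [hc0] using h5
      · simpa using h5
  obtain ⟨i, hi, hne⟩ := hX
  obtain ⟨k, rfl | rfl⟩ : ∃ k, i = 2 * k ∨ i = 2 * k + 1 := ⟨i / 2, by omega⟩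
  · exact hne (heven k (by omega))
  · rw [← hb0 k (by omega)] at hne
    exact hne (heven k (by omega))

/-- The form exceeds the lowest edge on all vectors, so no eigenvalue is at most that edge. -/
theorem eigCount_eq_zero {lam c : ℝ} (hc : c ^ 2 + lam * c = 1) (hpos : 0 < c) (ω : Config)
    (L : ℕ) : eigCount lam 0 0 ω L (-1 - c) = 0 := by
  rcases Nat.eq_zero_or_pos L with rfl | hL
  · exact eigCount_zero ..
  have := finrank_add_eigCount_le (lam := lam) (a := 0) (b := 0) (ω := ω) hL (zeroExtend L)
    (-1 - c) (zeroExtend_zero L)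
    fun x hx => lt_boxForm hc ω _ (zeroExtend_zero L x) (Or.inl hpos) ?_
  · rw [Module.finrank_fin_fun] at this
    omega
  · obtain ⟨i, hi⟩ := Function.ne_iff.1 hx
    refine ⟨i + 1, by omega, ?_⟩
    have := congrFun (boxRestrict_zeroExtend L x) i
    rw [boxRestrict_apply] at this
    rwa [this]

/-- The sequence that in each cell `k < L` is the multiple `t k` of the eigenvector of that cell. -/
def cellSpan (c : ℝ) (ω : Config) (L : ℕ) : (Fin L → ℝ) →ₗ[ℝ] (ℕ → ℝ) where
  toFun t i := if h : (i - 1) / 2 < L ∧ i ≠ 0 then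
    (if (ω ((i - 1) / 2 : ℕ) = 0 ↔ i % 2 = 1) then c else 1) * t ⟨(i - 1) / 2, h.1⟩ else 0
  map_add' t u := by
    funext i
    by_cases h : (i - 1) / 2 < L ∧ i ≠ 0
    · simp only [dif_pos h, Pi.add_apply, mul_add]
    · simp only [dif_neg h, Pi.add_apply, add_zero]
  map_smul' r t := by
    funext i
    by_cases h : (i - 1) / 2 < L ∧ i ≠ 0
    · simp only [dif_pos h, Pi.smul_apply, smul_eq_mul, mul_left_comm, RingHom.id_apply]
    · simp only [dif_neg h, Pi.smul_apply, smul_zero]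

@[simp] theorem cellSpan_zero (c : ℝ) (ω : Config) (L : ℕ) (t : Fin L → ℝ) :
    cellSpan c ω L t 0 = 0 := dif_neg (by simp)

theorem cellSpan_odd (c : ℝ) (ω : Config) {L k : ℕ} (hk : k < L) (t : Fin L → ℝ) :
    cellSpan c ω L t (2 * k + 1) = (if ω k = 0 then c else 1) * t ⟨k, hk⟩ := by
  have h : (2 * k + 1 - 1) / 2 = k := by omega
  have h2 : (2 * k + 1) % 2 = 1 := by omega
  refine (dif_pos ⟨by omega, by omega⟩).trans ?_
  simp only [h, h2, iff_true]

theorem cellSpan_even (c : ℝ) (ω : Config) {L k : ℕ} (hk : k < L) (t : Fin L → ℝ) :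
    cellSpan c ω L t (2 * k + 2) = (if ω k = 0 then 1 else c) * t ⟨k, hk⟩ := by
  have h : (2 * k + 2 - 1) / 2 = k := by omega
  have h2 : ¬ (2 * k + 2) % 2 = 1 := by omega
  refine (dif_pos ⟨by omega, by omega⟩).trans ?_
  simp only [h, h2, iff_false, ite_not]

theorem cellDev_cellSpan (c : ℝ) (ω : Config) {L k : ℕ} (hk : k < L) (t : Fin L → ℝ) :
    cellDev c ω k (cellSpan c ω L t) = 0 := by
  rw [cellDev, cellSpan_odd c ω hk, cellSpan_even c ω hk]
  split_ifs <;> ring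

theorem cellSpan_ne_zero {c : ℝ} (hc0 : c ≠ 0) (ω : Config) {L : ℕ} {t : Fin L → ℝ} (ht : t ≠ 0) :
    ∃ i, i < 2 * L ∧ cellSpan c ω L t (i + 1) ≠ 0 := by
  obtain ⟨k, hk⟩ := Function.ne_iff.1 ht
  refine ⟨2 * k, by omega, ?_⟩
  rw [cellSpan_odd c ω k.2]
  refine mul_ne_zero ?_ hk
  split_ifs
  exacts [hc0, one_ne_zero]

/-- Half of the eigenvalues exceed the upper edge of the gap: the form does so on the span of the
upper eigenvectors of the cells. -/
theorem eigCount_le_half {lam c : ℝ} (hc : c ^ 2 + lam * c = 1) (ω : Config) (L : ℕ) :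
    eigCount lam 0 0 ω L (-1 - c) ≤ L := by
  have hc0 : c ≠ 0 := by rintro rfl; simp at hc
  rcases Nat.eq_zero_or_pos L with rfl | hL
  · exact (eigCount_zero ..).le
  have := finrank_add_eigCount_le (lam := lam) (a := 0) (b := 0) (ω := ω) hL (cellSpan c ω L)
    (-1 - c) (cellSpan_zero c ω L) fun t ht => lt_boxForm hc ω _ (cellSpan_zero c ω L t)
      (Or.inr fun k hk => cellDev_cellSpan c ω hk t) ?_
  · rw [Module.finrank_fin_fun] at this
    omega
  · obtain ⟨i, hi, hne⟩ := cellSpan_ne_zero hc0 ω ht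
    exact ⟨i + 1, by omega, hne⟩

/-- Half of the eigenvalues are at most the lower edge `lam - (-1 - c)` of the gap, for the boundary
condition `1`: reflect the statement that the form with boundary condition `-1` is at least
`-1 - c` on the span of the upper eigenvectors of the cells. -/
theorem half_le_eigCount {lam c : ℝ} (hc : c ^ 2 + lam * c = 1) (ω : Config) (L : ℕ) :
    L ≤ eigCount lam 1 1 ω L (lam + 1 + c) := by
  have hc0 : c ≠ 0 := by rintro rfl; simp at hc
  rcases Nat.eq_zero_or_pos L with rfl | hL
  · exact Nat.zero_le _
  have := finrank_le_eigCount (lam := lam) (a := 1) (b := 1) (ω := ω) hL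
    (alternate ∘ₗ cellSpan c (flip ω) L) (lam + 1 + c) (fun t => by simp [alternate_apply])
    (fun t ht => ?_) fun t => ?_
  · rwa [Module.finrank_fin_fun] at this
  · by_contra hne
    obtain ⟨i, hi, h⟩ := cellSpan_ne_zero hc0 (flip ω) hne
    apply h
    have := congrFun ht ⟨i, hi⟩
    simpa [boxRestrict_apply, alternate_apply] using this
  · simp only [LinearMap.comp_apply]
    rw [boxForm_alternate, boxNormSq_alternate]
    set X := cellSpan c (flip ω) L t with hX
    have h1 := boxForm_sub_eq hc (flip ω) L X
    rw [Finset.sum_eq_zero (s := Finset.range L) (f := fun k => cellDev c (flip ω) k X ^ 2 / c)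
      fun k hk => by rw [hX, cellDev_cellSpan c (flip ω) (Finset.mem_range.1 hk)]; simp] at h1
    have hX0 : X 0 = 0 := cellSpan_zero ..
    have h2 : X 1 ^ 2 ≤ ∑ k ∈ Finset.range L, (X (2 * k) - X (2 * k + 1)) ^ 2 := by
      refine le_trans (le_of_eq ?_) (Finset.single_le_sum
        (f := fun k => (X (2 * k) - X (2 * k + 1)) ^ 2) (fun k _ => sq_nonneg _)
        (Finset.mem_range.2 hL))
      simp [hX0]
    rw [hX0] at h1
    simp only [boxForm] at h1 ⊢
    linarith

/-! ### The law of the displacements -/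

instance : IsProbabilityMeasure law := by unfold law; infer_instance

theorem siteLaw_singleton (x : Fin 2) : siteLaw {x} = 2⁻¹ := by
  rw [siteLaw, PMF.toMeasure_apply_singleton _ _ (measurableSet_singleton x)]
  simp

theorem law_map_comp {ι : Type*} {e : ι → ℤ} (he : Function.Injective e) :
    law.map (fun ω i => ω (e i)) = Measure.infinitePi fun _ : ι => siteLaw :=
  Measure.map_infinitePi_infinitePi_of_inj he

/-- The law of finitely many displacements is uniform. -/
theorem law_real_comp {ι : Type*} [Fintype ι] {e : ι → ℤ} (he : Function.Injective e)
    (p : (ι → Fin 2) → Prop) :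
    law.real {ω | p fun i => ω (e i)} = Nat.card {v // p v} / 2 ^ Fintype.card ι := by
  classical
  have hmeas : Measurable fun (ω : Config) (i : ι) => ω (e i) := by fun_prop
  have h1 : {ω : Config | p fun i => ω (e i)}
      = (fun (ω : Config) (i : ι) => ω (e i)) ⁻¹' {v | p v} :=
    rfl
  rw [h1, ← map_measureReal_apply hmeas (Set.toFinite _).measurableSet, law_map_comp he,
    Measure.infinitePi_eq_pi]
  have h2 : {v : ι → Fin 2 | p v} = ↑(Finset.univ.filter p) := by ext; simp
  rw [h2, ← sum_measureReal_singleton, Finset.sum_congr rfl (g := fun _ => (2 ^ Fintype.card ι)⁻¹)]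
  · rw [Finset.sum_const, nsmul_eq_mul, Nat.card_eq_fintype_card, Fintype.card_subtype,
      div_eq_mul_inv]
  · intro v _
    rw [Measure.real, Measure.pi_singleton]
    simp [siteLaw_singleton]

theorem measurePreserving_shiftConfig (j : ℤ) : MeasurePreserving (shiftConfig j) law law := by
  refine ⟨by unfold shiftConfig; fun_prop, ?_⟩
  exact law_map_comp (add_left_injective j)

theorem measurable_flip : Measurable flip :=
  measurable_pi_lambda _ fun k =>
    (Measurable.of_discrete (f := fun x : Fin 2 => if x = 0 then (1 : Fin 2) else 0)).comp
      (measurable_pi_apply k)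

theorem measurePreserving_flip : MeasurePreserving flip law law := by
  refine ⟨measurable_flip, ?_⟩
  have h1 : siteLaw.map (fun x : Fin 2 => if x = 0 then (1 : Fin 2) else 0) = siteLaw := by
    refine Measure.ext_of_singleton fun x => ?_
    rw [Measure.map_apply Measurable.of_discrete (measurableSet_singleton x)]
    have : (fun x : Fin 2 => if x = 0 then (1 : Fin 2) else 0) ⁻¹' {x}
        = {if x = 0 then (1 : Fin 2) else 0} := by
      ext y; fin_cases x <;> fin_cases y <;> simp
    rw [this, siteLaw_singleton, siteLaw_singleton]
  have h2 := Measure.infinitePi_map_pi (μ := fun _ : ℤ => siteLaw)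
    (f := fun _ (x : Fin 2) => if x = 0 then (1 : Fin 2) else 0) fun _ => Measurable.of_discrete
  rw [h1] at h2
  exact h2

/-- Almost surely every finite word occurs in the configuration. -/
theorem ae_exists_word {n : ℕ} (w : Fin n → Fin 2) :
    ∀ᵐ ω ∂law, ∃ j : ℤ, ∀ i : Fin n, ω (j + (i : ℕ)) = w i := by
  have hbound : ∀ K : ℕ, law.real {ω | ¬ ∃ j : ℤ, ∀ i : Fin n, ω (j + (i : ℕ)) = w i}
      ≤ (((2 : ℝ) ^ n - 1) / 2 ^ n) ^ K := by
    intro K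
    have he : Function.Injective fun p : Fin K × Fin n => (n : ℤ) * (p.1 : ℕ) + (p.2 : ℕ) := by
      rintro ⟨a, b⟩ ⟨a', b'⟩ h
      have h' : b.val + n * a.val = b'.val + n * a'.val := by
        have : (n : ℤ) * (a : ℕ) + (b : ℕ) = (n : ℤ) * (a' : ℕ) + (b' : ℕ) := h
        exact_mod_cast (by linarith : ((b : ℕ) : ℤ) + n * (a : ℕ) = (b' : ℕ) + n * (a' : ℕ))
      have hn : 0 < n := Nat.lt_of_le_of_lt (Nat.zero_le _) b.2
      have h1 := congrArg (· % n) h'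
      simp only [Nat.add_mul_mod_self_left, Nat.mod_eq_of_lt b.2, Nat.mod_eq_of_lt b'.2] at h1
      rw [h1, Nat.add_left_cancel_iff, Nat.mul_right_inj hn.ne'] at h'
      exact Prod.ext (Fin.ext h') (Fin.ext h1)
    have hcount := law_real_comp he fun v => ∀ b : Fin K, (fun i => v (b, i)) ≠ w
    have hcard : Nat.card {v : Fin K × Fin n → Fin 2 // ∀ b : Fin K, (fun i => v (b, i)) ≠ w}
        = (2 ^ n - 1) ^ K := by
      have e : {v : Fin K × Fin n → Fin 2 // ∀ b : Fin K, (fun i => v (b, i)) ≠ w}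
          ≃ (Fin K → {u : Fin n → Fin 2 // u ≠ w}) :=
        ((Equiv.curry (Fin K) (Fin n) (Fin 2)).subtypeEquiv fun v => Iff.rfl).trans
          (Equiv.subtypePiEquivPi (p := fun (_ : Fin K) (u : Fin n → Fin 2) => u ≠ w))
      rw [Nat.card_congr e, Nat.card_fun, Nat.card_eq_fintype_card, Fintype.card_subtype_compl]
      simp
    rw [hcard] at hcount
    refine (measureReal_mono ?_).trans (hcount.trans ?_).le
    · intro ω hω b hb
      exact hω ⟨n * (b : ℕ), fun i => congrFun hb i⟩
    · have : 1 ≤ 2 ^ n := Nat.one_le_two_pow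
      rw [Fintype.card_prod, Fintype.card_fin, Fintype.card_fin, div_pow, ← pow_mul, mul_comm n K]
      push_cast [this]
      rfl
  have hlim : Tendsto (fun K : ℕ => (((2 : ℝ) ^ n - 1) / 2 ^ n) ^ K) atTop (𝓝 0) := by
    have h1 : (1 : ℝ) ≤ 2 ^ n := one_le_pow₀ one_le_two
    refine tendsto_pow_atTop_nhds_zero_of_lt_one (div_nonneg (by linarith) (by linarith)) ?_
    rw [div_lt_one (by linarith)]
    linarith
  have h0 := ge_of_tendsto' hlim hbound
  rw [ae_iff, ← measureReal_eq_zero_iff]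
  exact le_antisymm h0 measureReal_nonneg

/-! ### Fluctuations of the simple random walk -/

/-- The step of the walk belonging to a displacement. -/
def step (x : Fin 2) : ℝ := if x = 0 then -1 else 1

theorem sum_walk_succ {m : ℕ} (f : ℝ → ℝ) :
    ∑ v : Fin (m + 1) → Fin 2, f (∑ i, step (v i))
      = ∑ v : Fin m → Fin 2, (f (-1 + ∑ i, step (v i)) + f (1 + ∑ i, step (v i))) := by
  rw [← (Fin.consEquiv fun _ : Fin (m + 1) => Fin 2).sum_comp, Fintype.sum_prod_type,
    Fin.sum_univ_two, ← Finset.sum_add_distrib]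
  simp [Fin.sum_univ_succ, Fin.consEquiv, step]

theorem sum_walk_sq (m : ℕ) :
    ∑ v : Fin m → Fin 2, (∑ i, step (v i)) ^ 2 = m * 2 ^ m := by
  induction m with
  | zero => simp
  | succ m ih =>
    rw [sum_walk_succ fun x => x ^ 2, Finset.sum_congr rfl
      (g := fun v : Fin m → Fin 2 => 2 * (∑ i, step (v i)) ^ 2 + 2) fun v _ => by ring,
      Finset.sum_add_distrib, ← Finset.mul_sum, ih]
    simp
    ring

theorem sum_walk_pow_four (m : ℕ) :
    ∑ v : Fin m → Fin 2, (∑ i, step (v i)) ^ 4 = (3 * m ^ 2 - 2 * m) * 2 ^ m := by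
  induction m with
  | zero => simp
  | succ m ih =>
    rw [sum_walk_succ fun x => x ^ 4, Finset.sum_congr rfl
      (g := fun v : Fin m → Fin 2 => 2 * (∑ i, step (v i)) ^ 4 + 12 * (∑ i, step (v i)) ^ 2 + 2)
      fun v _ => by ring,
      Finset.sum_add_distrib, Finset.sum_add_distrib, ← Finset.mul_sum, ← Finset.mul_sum, ih,
      sum_walk_sq]
    simp
    ring

/-- The walk reaches `√m / 2` at time `m` with a probability bounded below (second moment method).
-/
theorem card_walk_ge {m : ℕ} (hm : 0 < m) :
    (3 / 40 : ℝ) * 2 ^ m ≤ Nat.card {v : Fin m → Fin 2 // √m / 2 ≤ ∑ i, step (v i)} := by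
  classical
  have hm' : (0 : ℝ) < m := by exact_mod_cast hm
  set A : Finset (Fin m → Fin 2) := Finset.univ.filter fun v => √m / 2 ≤ ∑ i, step (v i) with hA
  set B : Finset (Fin m → Fin 2) := Finset.univ.filter fun v => √m / 2 ≤ -∑ i, step (v i) with hB
  have hAB : A.card = B.card := by
    refine Finset.card_bij' (fun v _ i => if v i = 0 then 1 else 0)
      (fun v _ i => if v i = 0 then 1 else 0) ?_ ?_ ?_ ?_
    · intro v hv
      simp only [hA, hB, Finset.mem_filter, Finset.mem_univ, true_and, ← Finset.sum_neg_distrib]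
        at hv ⊢
      refine hv.trans (le_of_eq (Finset.sum_congr rfl fun i _ => ?_))
      by_cases h : v i = 0 <;> simp [step, h]
    · intro v hv
      simp only [hA, hB, Finset.mem_filter, Finset.mem_univ, true_and, ← Finset.sum_neg_distrib]
        at hv ⊢
      refine hv.trans (le_of_eq (Finset.sum_congr rfl fun i _ => ?_))
      by_cases h : v i = 0 <;> simp [step, h]
    all_goals
      intro v _
      funext i
      have := Fin.exists_fin_two.1 ⟨v i, rfl⟩
      by_cases h : v i = 0
      · simp [h]
      · simp only [h, if_false, if_true]
        omega
  -- Pointwise, `x - 1/4 - x ^ 2 / 5` is at most the indicator of `1/4 ≤ x`, at `x = S ^ 2 / m`.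
  have hpt : ∀ v : Fin m → Fin 2, m * (∑ i, step (v i)) ^ 2 - (m : ℝ) ^ 2 / 4
      - (∑ i, step (v i)) ^ 4 / 5
      ≤ (m : ℝ) ^ 2 * ((if v ∈ A then 1 else 0) + (if v ∈ B then 1 else 0)) := by
    intro v
    set S := ∑ i, step (v i) with hS
    have hq : √(m : ℝ) ^ 2 = m := Real.sq_sqrt hm'.le
    by_cases h1 : v ∈ A
    · have : (0 : ℝ) ≤ if v ∈ B then 1 else 0 := by split_ifs <;> norm_num
      rw [if_pos h1]
      nlinarith [sq_nonneg (S ^ 2 - 5 / 2 * m), mul_nonneg (sq_nonneg (m : ℝ)) this]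
    · by_cases h2 : v ∈ B
      · rw [if_pos h2, if_neg h1]
        nlinarith [sq_nonneg (S ^ 2 - 5 / 2 * m)]
      · rw [if_neg h1, if_neg h2]
        simp only [hA, hB, Finset.mem_filter, Finset.mem_univ, true_and, not_le] at h1 h2
        have h3 : S ^ 2 < (√m / 2) ^ 2 := sq_lt_sq' (by linarith) h1
        have h4 : S ^ 4 = (S ^ 2) ^ 2 := by ring
        nlinarith [sq_nonneg (S ^ 2)]
  have hsum := Finset.sum_le_sum fun v (_ : v ∈ Finset.univ) => hpt v
  rw [Finset.sum_sub_distrib, Finset.sum_sub_distrib, ← Finset.mul_sum, ← Finset.sum_div,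
    ← Finset.sum_div, sum_walk_sq, sum_walk_pow_four, ← Finset.mul_sum, Finset.sum_add_distrib,
    Finset.sum_boole,
    Finset.sum_boole, Finset.filter_mem_eq_inter, Finset.filter_mem_eq_inter, Finset.univ_inter,
    Finset.univ_inter, ← hAB] at hsum
  simp only [Finset.sum_const, Finset.card_univ, Fintype.card_fun, Fintype.card_fin, nsmul_eq_mul,
    Nat.cast_pow, Nat.cast_ofNat] at hsum
  rw [Nat.card_eq_fintype_card, Fintype.card_subtype]
  have hpow : (0 : ℝ) < 2 ^ m := by positivity
  have h5 : (m : ℝ) ^ 2 * (3 / 40 * 2 ^ m) ≤ (m : ℝ) ^ 2 * A.card := by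
    nlinarith [mul_pos hm' hpow]
  exact le_of_mul_le_mul_left h5 (by positivity)

theorem card_walk_le {m : ℕ} (hm : 0 < m) :
    (3 / 40 : ℝ) * 2 ^ m ≤ Nat.card {v : Fin m → Fin 2 // ∑ i, step (v i) ≤ -(√m / 2)} := by
  refine (card_walk_ge hm).trans ?_
  norm_cast
  refine Nat.card_le_card_of_injective (fun v => ⟨fun i => if v.1 i = 0 then 1 else 0, ?_⟩) ?_
  · rw [le_neg, ← Finset.sum_neg_distrib]
    refine v.2.trans (le_of_eq (Finset.sum_congr rfl fun i _ => ?_))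
    by_cases h : v.1 i = 0 <;> simp [step, h]
  · intro v w h
    ext i
    have h1 := congrFun (congrArg Subtype.val h) i
    by_cases hv : v.1 i = 0 <;> by_cases hw : w.1 i = 0 <;>
      (simp [hv, hw] at h1 ⊢; try omega)

/-- The walk attached to a configuration. -/
def walk (ω : Config) (n : ℕ) : ℝ := ∑ k ∈ Finset.range n, step (ω k)

/-- With probability bounded below, the walk moves by `√m / 2` in the direction `s` up to time `m`
and back by the same amount up to time `2m`. -/
theorem law_bump_ge {m : ℕ} (hm : 0 < m) {s : ℝ} (hs : s = 1 ∨ s = -1) :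
    (3 / 40 : ℝ) ^ 2 ≤ law.real {ω | √m / 2 ≤ s * walk ω m ∧
      s * (walk ω (m + m) - walk ω m) ≤ -(√m / 2)} := by
  let e : Fin m ⊕ Fin m → ℤ := Sum.elim (fun i => (i : ℕ)) fun i => (m : ℤ) + (i : ℕ)
  have he : Function.Injective e := by
    rintro (a | a) (b | b) h <;> simp [e] at h <;> simp <;> omega
  have hw1 : ∀ ω : Config, walk ω m = ∑ i : Fin m, step (ω (e (Sum.inl i))) := fun ω =>
    (Fin.sum_univ_eq_sum_range (fun i => step (ω i)) m).symm
  have hw2 : ∀ ω : Config, walk ω (m + m) - walk ω m = ∑ i : Fin m, step (ω (e (Sum.inr i))) :=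
    fun ω => by
      rw [walk, walk, Finset.sum_range_add, add_sub_cancel_left]
      simp only [Nat.cast_add]
      exact (Fin.sum_univ_eq_sum_range (fun i => step (ω (m + i))) m).symm
  simp only [hw2]
  simp only [hw1]
  rw [law_real_comp he fun v => √m / 2 ≤ s * ∑ i, step (v (Sum.inl i)) ∧
      s * ∑ i, step (v (Sum.inr i)) ≤ -(√m / 2), Fintype.card_sum, Fintype.card_fin, pow_add]
  have e2 : {v : Fin m ⊕ Fin m → Fin 2 // √m / 2 ≤ s * ∑ i, step (v (Sum.inl i)) ∧
      s * ∑ i, step (v (Sum.inr i)) ≤ -(√m / 2)}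
      ≃ {v : Fin m → Fin 2 // √m / 2 ≤ s * ∑ i, step (v i)} ×
        {v : Fin m → Fin 2 // s * ∑ i, step (v i) ≤ -(√m / 2)} :=
    ((Equiv.sumArrowEquivProdArrow (Fin m) (Fin m) (Fin 2)).subtypeEquiv
      (q := fun p => √m / 2 ≤ s * ∑ i, step (p.1 i) ∧ s * ∑ i, step (p.2 i) ≤ -(√m / 2))
      fun v => Iff.rfl).trans (Equiv.subtypeProdEquivProd
        (p := fun v : Fin m → Fin 2 => √m / 2 ≤ s * ∑ i, step (v i))
        (q := fun v : Fin m → Fin 2 => s * ∑ i, step (v i) ≤ -(√m / 2)))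
  rw [Nat.card_congr e2, Nat.card_prod, le_div_iff₀ (by positivity)]
  push_cast
  rw [sq, mul_mul_mul_comm]
  have h0 : (0 : ℝ) ≤ 3 / 40 * 2 ^ m := by positivity
  rcases hs with rfl | rfl
  · simp only [one_mul]
    exact mul_le_mul (card_walk_ge hm) (card_walk_le hm) h0 (Nat.cast_nonneg _)
  · simp only [neg_one_mul, neg_le_neg_iff, le_neg]
    have h1 := card_walk_le hm
    have h2 := card_walk_ge hm
    exact mul_le_mul (by simpa only [le_neg] using h1) h2 h0 (Nat.cast_nonneg _)

/-! ### Approximate eigenvectors from excursions of the walk -/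

/-- The common value at the sites `2k` and `2k + 1` of the solution of the eigenvalue equation at the
energy `-1 - c` that is equal on both sides of each bond between cells. Up to sign it is the
exponential of `log |c|` times the walk. -/
def growth (c : ℝ) (ω : Config) (k : ℕ) : ℝ :=
  ∏ i ∈ Finset.range k, if ω i = 0 then c⁻¹ else c

theorem growth_zero (c : ℝ) (ω : Config) : growth c ω 0 = 1 := by simp [growth]

theorem growth_succ (c : ℝ) (ω : Config) (k : ℕ) :
    growth c ω (k + 1) = growth c ω k * if ω k = 0 then c⁻¹ else c :=
  Finset.prod_range_succ _ _

theorem growth_sq {c : ℝ} (hc0 : c ≠ 0) (ω : Config) (k : ℕ) :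
    growth c ω k ^ 2 = Real.exp (2 * (Real.log c * walk ω k)) := by
  induction k with
  | zero => simp [growth, walk]
  | succ k ih =>
    have hlog : Real.exp (2 * Real.log c) = c ^ 2 := by
      rw [← Real.log_abs, ← sq_abs, two_mul, Real.exp_add, Real.exp_log (abs_pos.2 hc0), sq]
    rw [growth_succ, mul_pow, ih, walk, walk, Finset.sum_range_succ, mul_add, mul_add, Real.exp_add]
    congr 1
    unfold step
    split_ifs
    · rw [mul_neg_one, mul_neg, Real.exp_neg, hlog, inv_pow]
    · rw [mul_one, hlog]

/-- The sequence `i ↦ growth c ω (i / 2)` solves the eigenvalue equation at the energy `-1 - c`. -/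
theorem growth_equation {lam c : ℝ} (hc : c ^ 2 + lam * c = 1) (ω : Config) (i : ℕ) :
    (potential lam ω (i + 1 : ℤ) - (-1 - c)) * growth c ω ((i + 1) / 2)
      = growth c ω (i / 2) + growth c ω ((i + 2) / 2) := by
  have hc0 : c ≠ 0 := by rintro rfl; simp at hc
  obtain ⟨k, rfl | rfl⟩ : ∃ k, i = 2 * k ∨ i = 2 * k + 1 := ⟨i / 2, by omega⟩
  · rw [show (2 * k + 1) / 2 = k by omega, show 2 * k / 2 = k by omega,
      show (2 * k + 2) / 2 = k + 1 by omega, growth_succ]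
    push_cast
    rw [potential_odd]
    split_ifs
    · field_simp
      linear_combination growth c ω k * hc
    · ring
  · rw [show (2 * k + 1 + 1) / 2 = k + 1 by omega, show (2 * k + 1) / 2 = k by omega,
      show (2 * k + 1 + 2) / 2 = k + 1 by omega, growth_succ]
    push_cast
    rw [add_assoc, show (1 + 1 : ℤ) = 2 from rfl, potential_even]
    split_ifs
    · field_simp
      ring
    · linear_combination growth c ω k * hc

/-- An excursion of the walk yields an eigenvalue near the band edge. The growth function, cut off to
the box with boundary condition `1`, satisfies the eigenvalue equation except at the two ends, where
the error is twice its value. -/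
theorem exists_eigenvalue_of_growth {lam c : ℝ} (hc : c ^ 2 + lam * c = 1) (ω : Config) {L m : ℕ}
    (hm : m < L) {δ : ℝ} (hδ : 0 ≤ δ)
    (h : 4 * (1 + growth c ω L ^ 2) ≤ δ ^ 2 * growth c ω m ^ 2) :
    ∃ k, |(boxMatrix_isHermitian lam 1 1 ω L).eigenvalues k - (-1 - c)| ≤ δ := by
  set X : ℕ → ℝ := fun i => growth c ω (i / 2) with hX
  have hnorm : growth c ω m ^ 2 ≤ boxRestrict L X ⬝ᵥ boxRestrict L X := by
    rw [boxRestrict_dotProduct_self, boxNormSq]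
    refine le_trans ?_ (Finset.single_le_sum
      (f := fun k => X (2 * k + 1) ^ 2 + X (2 * k + 2) ^ 2) (fun k _ => by positivity)
      (Finset.mem_range.2 hm))
    have : X (2 * m + 1) = growth c ω m := by simp only [hX]; congr 1; omega
    rw [this]
    linarith [sq_nonneg (X (2 * m + 2))]
  have hdiff : ∀ i : Fin (2 * L),
      ((boxMatrix lam 1 1 ω L).mulVec (boxRestrict L X) - (-1 - c) • boxRestrict L X) i
        = (if (i : ℕ) = 0 then 2 else 0)
          + (if (i : ℕ) + 1 = 2 * L then 2 * growth c ω L else 0) := by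
    intro i
    have heq := growth_equation hc ω i
    rw [Pi.sub_apply, Pi.smul_apply, boxMatrix_mulVec, boxRestrict_apply, smul_eq_mul]
    simp only [hX]
    by_cases h0 : (i : ℕ) = 0
    · have h1 : ¬ (i : ℕ) + 1 = 2 * L := by omega
      simp only [h1, if_false, if_pos h0]
      have h2 : growth c ω ((i + 1) / 2) = 1 := by rw [h0]; exact growth_zero c ω
      have h3 : growth c ω (i / 2) = 1 := by rw [h0]; exact growth_zero c ω
      rw [h2, h3] at heq
      rw [h2]
      linarith
    · by_cases h1 : (i : ℕ) + 1 = 2 * L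
      · simp only [if_neg h0, if_pos h1]
        have h2 : ((i : ℕ) + 1) / 2 = L := by omega
        have h3 : ((i : ℕ) + 2) / 2 = L := by omega
        rw [h2, h3] at heq
        rw [h2]
        linarith
      · simp only [if_neg h0, if_neg h1]
        linarith
  refine exists_eigenvalue_near _ (-1 - c) δ hδ (boxRestrict L X) (fun h0 => ?_) ?_
  · rw [h0, zero_dotProduct] at hnorm
    have : 0 < growth c ω L ^ 2 + 1 := by positivity
    nlinarith [sq_nonneg δ, sq_nonneg (growth c ω m)]
  · refine le_trans (le_trans (le_of_eq ?_) h) (mul_le_mul_of_nonneg_left hnorm (sq_nonneg δ))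
    have h1 : ∀ i : Fin (2 * L), ((if (i : ℕ) = 0 then 2 else 0)
          + (if (i : ℕ) + 1 = 2 * L then 2 * growth c ω L else 0)) *
          ((if (i : ℕ) = 0 then 2 else 0)
          + (if (i : ℕ) + 1 = 2 * L then 2 * growth c ω L else 0))
        = (if i = ⟨0, by omega⟩ then 4 else 0)
          + (if i = ⟨2 * L - 1, by omega⟩ then 4 * growth c ω L ^ 2 else 0) := by
      intro i
      have e1 : ((i : ℕ) = 0) ↔ i = ⟨0, by omega⟩ := by rw [Fin.ext_iff]
      have e2 : ((i : ℕ) + 1 = 2 * L) ↔ i = ⟨2 * L - 1, by omega⟩ := by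
        rw [Fin.ext_iff]; show _ ↔ (i : ℕ) = 2 * L - 1; omega
      rw [← if_congr e1 rfl rfl, ← if_congr e2 rfl rfl]
      by_cases h0 : (i : ℕ) = 0
      · have h1 : ¬ (i : ℕ) + 1 = 2 * L := by omega
        simp only [if_pos h0, if_neg h1]; norm_num
      · simp only [if_neg h0]
        split_ifs <;> ring
    simp only [dotProduct, hdiff, h1]
    rw [Finset.sum_add_distrib, Finset.sum_ite_eq', Finset.sum_ite_eq',
      if_pos (Finset.mem_univ _), if_pos (Finset.mem_univ _)]
    ring

theorem eigCount_lt_of_growth {lam c : ℝ} (hc : c ^ 2 + lam * c = 1) (ω : Config) {L m : ℕ}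
    (hm : m < L) {δ E₁ : ℝ} (hδ : 0 ≤ δ) (hE₁ : E₁ < -1 - c - δ)
    (h : 4 * (1 + growth c ω L ^ 2) ≤ δ ^ 2 * growth c ω m ^ 2) :
    eigCount lam 1 1 ω L E₁ + 1 ≤ eigCount lam 1 1 ω L (-1 - c + δ) := by
  classical
  obtain ⟨k, hk⟩ := exists_eigenvalue_of_growth hc ω hm hδ h
  rw [abs_le] at hk
  unfold eigCount
  rw [Nat.card_eq_fintype_card, Nat.card_eq_fintype_card, Fintype.card_subtype,
    Fintype.card_subtype, Nat.succ_le_iff]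
  refine Finset.card_lt_card ((Finset.ssubset_iff_of_subset ?_).2 ⟨k, ?_, ?_⟩)
  · intro i hi
    rw [Finset.mem_filter] at hi ⊢
    exact ⟨hi.1, by linarith [hi.2]⟩
  · rw [Finset.mem_filter]
    exact ⟨Finset.mem_univ _, by linarith [hk.2]⟩
  · rw [Finset.mem_filter]
    rintro ⟨-, h2⟩
    linarith [hk.1]

/-! ### The integrated density of states as a supremum -/

theorem eigCount_congr (lam a b : ℝ) {ω ω' : Config} (L : ℕ) (E : ℝ)
    (h : ∀ k : ℕ, k < L → ω k = ω' k) : eigCount lam a b ω L E = eigCount lam a b ω' L E := by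
  have hmat : boxMatrix lam a b ω L = boxMatrix lam a b ω' L := by
    ext i j
    have : potential lam ω ((i : ℕ) + 1 : ℤ) = potential lam ω' ((i : ℕ) + 1 : ℤ) := by
      obtain ⟨k, hk | hk⟩ : ∃ k, (i : ℕ) = 2 * k ∨ (i : ℕ) = 2 * k + 1 := ⟨i / 2, by omega⟩
      · rw [hk]; push_cast; rw [potential_odd, potential_odd, h k (by omega)]
      · rw [hk]; push_cast
        rw [add_assoc, show (1 + 1 : ℤ) = 2 from rfl, potential_even, potential_even,
          h k (by omega)]
    simp only [boxMatrix, Matrix.of_apply, this]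
  have : ∀ (A B : Matrix (Fin (2 * L)) (Fin (2 * L)) ℝ) (hA : A.IsHermitian) (hB : B.IsHermitian),
      A = B → Nat.card {k // hA.eigenvalues k ≤ E} = Nat.card {k // hB.eigenvalues k ≤ E} := by
    rintro A _ hA hB rfl; rfl
  exact this _ _ _ _ hmat

theorem measurable_eigCount (lam a b : ℝ) (L : ℕ) (E : ℝ) :
    Measurable fun ω => (eigCount lam a b ω L E : ℝ) := by
  let g : (Fin L → Fin 2) → ℝ := fun v =>
    eigCount lam a b (fun k => if h : k.toNat < L then v ⟨k.toNat, h⟩ else 0) L E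
  have h1 : (fun ω => (eigCount lam a b ω L E : ℝ)) = g ∘ fun ω (i : Fin L) => ω (i : ℕ) := by
    funext ω
    simp only [g, Function.comp_apply, Nat.cast_inj]
    refine eigCount_congr lam a b L E fun k hk => ?_
    simp [hk]
  rw [h1]
  exact Measurable.of_discrete.comp (by fun_prop)

theorem integrable_eigCount (lam a b : ℝ) (L : ℕ) (E : ℝ) :
    Integrable (fun ω => (eigCount lam a b ω L E : ℝ)) law := by
  refine Integrable.of_bound (measurable_eigCount lam a b L E).aestronglyMeasurable
    ((2 * L : ℕ) : ℝ) (ae_of_all _ fun ω => ?_)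
  rw [Real.norm_eq_abs, Nat.abs_cast]
  exact_mod_cast eigCount_le lam a b ω L E

/-- The expected number of eigenvalues `≤ E` of the box. -/
def meanCount (lam a b : ℝ) (L : ℕ) (E : ℝ) : ℝ := ∫ ω, (eigCount lam a b ω L E : ℝ) ∂law

theorem boxIDS_eq (lam a b : ℝ) (L : ℕ) (E : ℝ) :
    boxIDS lam a b L E = meanCount lam a b L E / (2 * L) := by
  rw [boxIDS, meanCount, one_div, inv_mul_eq_div]

theorem meanCount_le_of_forall {lam a b : ℝ} {L : ℕ} {E C : ℝ}
    (h : ∀ ω, (eigCount lam a b ω L E : ℝ) ≤ C) : meanCount lam a b L E ≤ C := by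
  refine (integral_mono (integrable_eigCount lam a b L E) (integrable_const C) h).trans ?_
  simp

theorem meanCount_add_le (lam : ℝ) (L M : ℕ) (E : ℝ) :
    meanCount lam 1 1 L E + meanCount lam 1 1 M E ≤ meanCount lam 1 1 (L + M) E := by
  have h1 : meanCount lam 1 1 M E
      = ∫ ω, (eigCount lam 1 1 (shiftConfig L ω) M E : ℝ) ∂law := by
    conv_lhs => rw [meanCount, ← (measurePreserving_shiftConfig (L : ℤ)).map_eq]
    exact integral_map (measurePreserving_shiftConfig _).measurable.aemeasurable
      (measurable_eigCount lam 1 1 M E).aestronglyMeasurable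
  have h2 : Integrable (fun ω => (eigCount lam 1 1 (shiftConfig L ω) M E : ℝ)) law :=
    (measurePreserving_shiftConfig (L : ℤ)).integrable_comp_of_integrable
      (integrable_eigCount lam 1 1 M E)
  rw [h1, meanCount, ← integral_add (integrable_eigCount lam 1 1 L E) h2]
  refine integral_mono ((integrable_eigCount lam 1 1 L E).add h2)
    (integrable_eigCount lam 1 1 (L + M) E) fun ω => ?_
  exact_mod_cast eigCount_add_le lam ω L M E

theorem subadditive_neg_meanCount (lam E : ℝ) : Subadditive fun L => -meanCount lam 1 1 L E :=
  fun L M => by linarith [meanCount_add_le lam L M E]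

theorem bddBelow_neg_meanCount (lam E : ℝ) :
    BddBelow (Set.range fun L : ℕ => -meanCount lam 1 1 L E / L) := by
  refine ⟨-2, ?_⟩
  rintro _ ⟨L, rfl⟩
  rcases Nat.eq_zero_or_pos L with rfl | hL
  · norm_num
  · have h1 : meanCount lam 1 1 L E ≤ 2 * L := meanCount_le_of_forall fun ω => by
      exact_mod_cast eigCount_le lam 1 1 ω L E
    have hL' : (0 : ℝ) < L := by exact_mod_cast hL
    show -2 ≤ -meanCount lam 1 1 L E / L
    rw [le_div_iff₀ hL']
    linarith

theorem abs_meanCount_sub_le (lam a b a' b' : ℝ) (L : ℕ) (E : ℝ) :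
    |meanCount lam a b L E - meanCount lam a' b' L E| ≤ 2 := by
  have key : ∀ a b a' b' : ℝ, meanCount lam a b L E ≤ meanCount lam a' b' L E + 2 := by
    intro a b a' b'
    have h1 : ∀ ω, (eigCount lam a b ω L E : ℝ) ≤ eigCount lam a' b' ω L E + 2 := fun ω => by
      exact_mod_cast eigCount_le_add_two lam a b a' b' ω L E
    have h2 := integral_mono (integrable_eigCount lam a b L E)
      ((integrable_eigCount lam a' b' L E).add (integrable_const 2)) h1
    rw [Pi.add_def, integral_add (integrable_eigCount lam a' b' L E) (integrable_const 2)] at h2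
    simpa [meanCount] using h2
  rw [abs_le]
  constructor <;> linarith [key a b a' b', key a' b' a b]

theorem tendsto_boxIDS_aux (lam : ℝ) (a b : ℕ → ℝ) (E : ℝ) :
    Tendsto (fun L : ℕ => boxIDS lam (a L) (b L) L E) atTop
      (𝓝 (-(subadditive_neg_meanCount lam E).lim / 2)) := by
  have h1 := ((subadditive_neg_meanCount lam E).tendsto_lim
    (bddBelow_neg_meanCount lam E)).neg.div_const 2
  have h2 : Tendsto (fun L : ℕ => boxIDS lam (a L) (b L) L E - boxIDS lam 1 1 L E) atTop (𝓝 0) := by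
    refine squeeze_zero_norm (a := fun L : ℕ => (1 : ℝ) / L) (fun L => ?_)
      tendsto_one_div_atTop_nhds_zero_nat
    rw [boxIDS_eq, boxIDS_eq, ← sub_div, norm_div, Real.norm_eq_abs, Real.norm_eq_abs,
      abs_of_nonneg (by positivity : (0 : ℝ) ≤ 2 * L), ← div_div]
    gcongr
    linarith [abs_meanCount_sub_le lam (a L) (b L) 1 1 L E]
  have h3 := h2.add h1
  rw [zero_add] at h3
  refine h3.congr fun L => ?_
  rw [boxIDS_eq lam 1 1]
  ring

theorem IDS_eq (lam E : ℝ) : IDS lam E = -(subadditive_neg_meanCount lam E).lim / 2 :=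
  (tendsto_boxIDS_aux lam (fun _ => 0) (fun _ => 0) E).limUnder_eq

theorem tendsto_boxIDS (lam : ℝ) (a b : ℕ → ℝ) (E : ℝ) :
    Tendsto (fun L : ℕ => boxIDS lam (a L) (b L) L E) atTop (𝓝 (IDS lam E)) :=
  IDS_eq lam E ▸ tendsto_boxIDS_aux lam a b E

/-- By superadditivity every box with boundary condition `1` bounds the density of states below. -/
theorem boxIDS_le_IDS (lam E : ℝ) {L : ℕ} (hL : 0 < L) : boxIDS lam 1 1 L E ≤ IDS lam E := by
  have h := (subadditive_neg_meanCount lam E).lim_le_div (bddBelow_neg_meanCount lam E) hL.ne'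
  rw [IDS_eq, boxIDS_eq, mul_comm, ← div_div]
  have h2 : -meanCount lam 1 1 L E / L = -(meanCount lam 1 1 L E / L) := neg_div _ _
  linarith

theorem meanCount_flip (lam a b : ℝ) (L : ℕ) (E : ℝ) :
    ∫ ω, (eigCount lam a b (flip ω) L E : ℝ) ∂law = meanCount lam a b L E := by
  conv_rhs => rw [meanCount, ← measurePreserving_flip.map_eq]
  exact (integral_map measurePreserving_flip.measurable.aemeasurable
    (measurable_eigCount lam a b L E).aestronglyMeasurable).symm

theorem integrable_eigCount_flip (lam a b : ℝ) (L : ℕ) (E : ℝ) :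
    Integrable (fun ω => (eigCount lam a b (flip ω) L E : ℝ)) law :=
  measurePreserving_flip.integrable_comp_of_integrable (integrable_eigCount lam a b L E)

theorem one_le_IDS_add (lam E : ℝ) : 1 ≤ IDS lam E + IDS lam (lam - E) := by
  refine ge_of_tendsto ((tendsto_boxIDS lam (fun _ => 0) (fun _ => 0) E).add
    (tendsto_boxIDS lam (fun _ => -0) (fun _ => -0) (lam - E))) ?_
  filter_upwards [eventually_gt_atTop 0] with L hL
  have hL' : (0 : ℝ) < L := by exact_mod_cast hL
  rw [boxIDS_eq, boxIDS_eq, ← add_div, le_div_iff₀ (by positivity), one_mul,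
    ← meanCount_flip lam (-0), meanCount,
    ← integral_add (integrable_eigCount ..) (integrable_eigCount_flip ..)]
  have h := integral_mono (integrable_const ((2 * L : ℕ) : ℝ)) ((integrable_eigCount lam 0 0 L E).add
    (integrable_eigCount_flip lam (-0) (-0) L (lam - E))) fun ω => by
      simp only [Pi.add_apply]
      exact_mod_cast two_mul_le_eigCount_add lam 0 0 ω L E
  simpa using h

theorem IDS_add_le_one (lam : ℝ) {E E' : ℝ} (hE : E + E' < lam) : IDS lam E + IDS lam E' ≤ 1 := by
  refine le_of_tendsto ((tendsto_boxIDS lam (fun _ => 0) (fun _ => 0) E).add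
    (tendsto_boxIDS lam (fun _ => -0) (fun _ => -0) E')) ?_
  filter_upwards [eventually_gt_atTop 0] with L hL
  have hL' : (0 : ℝ) < L := by exact_mod_cast hL
  rw [boxIDS_eq, boxIDS_eq, ← add_div, div_le_iff₀ (by positivity), one_mul,
    ← meanCount_flip lam (-0), meanCount,
    ← integral_add (integrable_eigCount ..) (integrable_eigCount_flip ..)]
  have h := integral_mono ((integrable_eigCount lam 0 0 L E).add
    (integrable_eigCount_flip lam (-0) (-0) L E')) (integrable_const ((2 * L : ℕ) : ℝ)) fun ω => by
      simp only [Pi.add_apply]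
      exact_mod_cast eigCount_add_le_two_mul lam 0 0 ω L hE
  simpa using h

/-! ### The spectrum of the operators on `ℓ²(ℤ)` -/

theorem hasSum_norm_sq (u : Ell2) : HasSum (fun n => ‖u n‖ ^ 2) (‖u‖ ^ 2) := by
  have h := lp.hasSum_norm (p := 2) (by simp) u
  simpa using h

/-- Composition with a permutation of `ℤ`, as an operator on `ℓ²(ℤ)`. -/
def permOp (e : Equiv.Perm ℤ) : Ell2 →L[ℂ] Ell2 :=
  LinearMap.mkContinuous
    { toFun := fun u => ⟨fun n => u (e n), by
        refine memℓp_gen ?_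
        exact (e.summable_iff (f := fun n => ‖u n‖ ^ (2 : ENNReal).toReal)).2
          ((lp.memℓp u).summable (by simp))⟩
      map_add' := fun u v => rfl
      map_smul' := fun c u => rfl } 1 (by
    intro u
    rw [one_mul]
    refine lp.norm_le_of_tsum_le (by simp) (norm_nonneg _) ?_
    rw [lp.norm_rpow_eq_tsum (by simp) u]
    exact (e.tsum_eq (fun n => ‖u n‖ ^ (2 : ENNReal).toReal)).le)

theorem norm_permOp_le (e : Equiv.Perm ℤ) : ‖permOp e‖ ≤ 1 :=
  LinearMap.mkContinuous_norm_le _ zero_le_one _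

/-- The exchange of the two sites of each cell `{2k + 1, 2k + 2}`. -/
def cellSwap : Equiv.Perm ℤ :=
  Function.Involutive.toPerm (fun n => if n % 2 = 1 then n + 1 else n - 1) fun n => by
    by_cases h : n % 2 = 1
    · simp only [h, if_true]; rw [if_neg (by omega)]; ring
    · simp only [h, if_false]; rw [if_pos (by omega)]; ring

/-- The exchange of the two sites `2k`, `2k + 1` of each bond between neighbouring cells. -/
def bondSwap : Equiv.Perm ℤ :=
  Function.Involutive.toPerm (fun n => if n % 2 = 1 then n - 1 else n + 1) fun n => by
    by_cases h : n % 2 = 1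
    · simp only [h, if_true]; rw [if_neg (by omega)]; ring
    · simp only [h, if_false]; rw [if_pos (by omega)]; ring

theorem cellSwap_apply (n : ℤ) : cellSwap n = if n % 2 = 1 then n + 1 else n - 1 := rfl

theorem bondSwap_apply (n : ℤ) : bondSwap n = if n % 2 = 1 then n - 1 else n + 1 := rfl

theorem cellSwap_cellSwap (n : ℤ) : cellSwap (cellSwap n) = n := by
  rw [cellSwap_apply, cellSwap_apply]
  split_ifs <;> omega

theorem potential_cellSwap (lam : ℝ) (ω : Config) (n : ℤ) :
    potential lam ω (cellSwap n) = lam - potential lam ω n := by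
  obtain ⟨k, rfl | rfl⟩ : ∃ k, n = 2 * k + 1 ∨ n = 2 * k + 2 := ⟨(n - 1) / 2, by omega⟩
  · rw [cellSwap_apply, if_pos (by omega), add_assoc, show (1 + 1 : ℤ) = 2 from rfl,
      potential_odd, potential_even]
    split_ifs <;> simp
  · rw [cellSwap_apply, if_neg (by omega), show 2 * k + 2 - 1 = 2 * k + 1 by ring,
      potential_odd, potential_even]
    split_ifs <;> simp

theorem sq_potential_sub_half (lam : ℝ) (ω : Config) (n : ℤ) :
    (potential lam ω n - lam / 2) ^ 2 = (lam / 2) ^ 2 := by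
  rw [potential_eq]; split_ifs <;> ring

/-- The part of the Hamiltonian, centred at `lam / 2`, that acts inside the cells. -/
def cellPart (lam : ℝ) (ω : Config) : Ell2 →L[ℂ] Ell2 :=
  mulPotential lam ω - ((lam / 2 : ℝ) : ℂ) • 1 - permOp cellSwap

theorem cellPart_apply (lam : ℝ) (ω : Config) (u : Ell2) (n : ℤ) :
    cellPart lam ω u n = ((potential lam ω n - lam / 2 : ℝ) : ℂ) * u n - u (cellSwap n) := by
  have : cellPart lam ω u n
      = (potential lam ω n : ℂ) * u n - ((lam / 2 : ℝ) : ℂ) * u n - u (cellSwap n) := rfl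
  rw [this]; push_cast; ring

theorem hamiltonian_eq (lam : ℝ) (ω : Config) :
    hamiltonian lam ω = cellPart lam ω + ((lam / 2 : ℝ) : ℂ) • 1 - permOp bondSwap := by
  ext u n
  have h1 : (cellPart lam ω + ((lam / 2 : ℝ) : ℂ) • 1 - permOp bondSwap) u n
      = cellPart lam ω u n + ((lam / 2 : ℝ) : ℂ) * u n - u (bondSwap n) := rfl
  rw [h1, hamiltonian_apply, cellPart_apply, cellSwap_apply, bondSwap_apply]
  push_cast
  split_ifs <;> ring

theorem cellPart_mul_self (lam : ℝ) (ω : Config) :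
    cellPart lam ω * cellPart lam ω = (((lam / 2) ^ 2 + 1 : ℝ) : ℂ) • 1 := by
  ext u n
  have h1 : (cellPart lam ω * cellPart lam ω) u n = cellPart lam ω (cellPart lam ω u) n := rfl
  have h2 : ((((lam / 2) ^ 2 + 1 : ℝ) : ℂ) • (1 : Ell2 →L[ℂ] Ell2)) u n
      = (((lam / 2) ^ 2 + 1 : ℝ) : ℂ) * u n := rfl
  rw [h1, h2, cellPart_apply, cellPart_apply, cellPart_apply, cellSwap_cellSwap,
    potential_cellSwap, ← sq_potential_sub_half lam ω n]
  push_cast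
  ring

theorem norm_cellPart_le (lam : ℝ) (ω : Config) : ‖cellPart lam ω‖ ≤ √((lam / 2) ^ 2 + 1) := by
  refine ContinuousLinearMap.opNorm_le_bound _ (Real.sqrt_nonneg _) fun u => ?_
  have hA := hasSum_norm_sq (cellPart lam ω u)
  have hA' := (cellSwap.hasSum_iff (f := fun n => ‖cellPart lam ω u n‖ ^ 2)).2 hA
  have hu := hasSum_norm_sq u
  have hu' := (cellSwap.hasSum_iff (f := fun n => ‖u n‖ ^ 2)).2 hu
  have hpt : ∀ n, ‖cellPart lam ω u n‖ ^ 2 + ‖cellPart lam ω u (cellSwap n)‖ ^ 2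
      = ((lam / 2) ^ 2 + 1) * (‖u n‖ ^ 2 + ‖u (cellSwap n)‖ ^ 2) := by
    intro n
    rw [cellPart_apply, cellPart_apply, cellSwap_cellSwap, potential_cellSwap,
      ← sq_potential_sub_half lam ω n]
    simp only [Complex.sq_norm, Complex.normSq_apply, Complex.sub_re, Complex.sub_im,
      Complex.re_ofReal_mul, Complex.im_ofReal_mul]
    ring
  have h1 := hA.add hA'
  have h2 := (hu.add hu').mul_left ((lam / 2) ^ 2 + 1)
  have h3 := h1.unique (h2.congr_fun fun n => hpt n)
  have h4 : ‖cellPart lam ω u‖ ^ 2 = (√((lam / 2) ^ 2 + 1) * ‖u‖) ^ 2 := by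
    rw [mul_pow, Real.sq_sqrt (by positivity)]
    linarith
  exact ((sq_eq_sq₀ (norm_nonneg _) (by positivity)).1 h4).le

theorem mem_spec_iff {lam : ℝ} {ω : Config} {E : ℝ} :
    E ∈ spec lam ω ↔ ¬ IsUnit ((E : ℂ) • (1 : Ell2 →L[ℂ] Ell2) - hamiltonian lam ω) := by
  rw [spec, Set.mem_ofPred_eq, spectrum.mem_iff, Algebra.algebraMap_eq_smul_one]

/-- The spectrum lies in the ball of radius `√((lam / 2) ^ 2 + 1) + 1` about `lam / 2`. -/
theorem abs_sub_le_of_mem_spec {lam : ℝ} {ω : Config} {E : ℝ} (hE : E ∈ spec lam ω) :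
    |E - lam / 2| ≤ √((lam / 2) ^ 2 + 1) + 1 := by
  have h1 : ((E - lam / 2 : ℝ) : ℂ) ∈ spectrum ℂ (cellPart lam ω - permOp bondSwap) := by
    rw [spectrum.mem_iff, Algebra.algebraMap_eq_smul_one]
    rw [mem_spec_iff, hamiltonian_eq] at hE
    convert hE using 2
    push_cast
    module
  have h2 := spectrum.norm_le_norm_mul_of_mem h1
  rw [Complex.norm_real, Real.norm_eq_abs] at h2
  refine h2.trans ?_
  have h3 : ‖cellPart lam ω - permOp bondSwap‖ ≤ √((lam / 2) ^ 2 + 1) + 1 :=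
    (norm_sub_le _ _).trans (add_le_add (norm_cellPart_le lam ω) (norm_permOp_le _))
  calc _ ≤ (√((lam / 2) ^ 2 + 1) + 1) * 1 :=
        mul_le_mul h3 ContinuousLinearMap.norm_id_le (norm_nonneg _) (by positivity)
    _ = _ := mul_one _

/-- The spectrum stays away from `lam / 2`: the part inside the cells is invertible with inverse of
norm `1 / √((lam / 2) ^ 2 + 1)`, and the bonds are a perturbation of norm `1`. -/
theorem le_abs_sub_of_mem_spec {lam : ℝ} {ω : Config} {E : ℝ} (hE : E ∈ spec lam ω) :
    √((lam / 2) ^ 2 + 1) - 1 ≤ |E - lam / 2| := by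
  by_contra! hlt
  rw [mem_spec_iff] at hE
  apply hE
  set s := √((lam / 2) ^ 2 + 1) with hs
  have hs0 : 0 < s := Real.sqrt_pos.2 (by positivity)
  have hs2 : s ^ 2 = (lam / 2) ^ 2 + 1 := Real.sq_sqrt (by positivity)
  set A := cellPart lam ω with hA
  set B : Ell2 →L[ℂ] Ell2 := ((E - lam / 2 : ℝ) : ℂ) • 1 + permOp bondSwap with hB
  have hAA : A * A = ((s ^ 2 : ℝ) : ℂ) • 1 := by rw [hA, cellPart_mul_self, hs2]
  have hs2C : ((s ^ 2 : ℝ) : ℂ) ≠ 0 := Complex.ofReal_ne_zero.2 (by positivity)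
  set A' := (((s ^ 2 : ℝ) : ℂ)⁻¹) • A with hA'
  have hl : A' * A = 1 := by rw [hA', smul_mul_assoc, hAA, smul_smul, inv_mul_cancel₀ hs2C, one_smul]
  have hr : A * A' = 1 := by rw [hA', mul_smul_comm, hAA, smul_smul, inv_mul_cancel₀ hs2C, one_smul]
  have hfac : (E : ℂ) • (1 : Ell2 →L[ℂ] Ell2) - hamiltonian lam ω = -(A * (1 - A' * B)) := by
    rw [mul_sub, mul_one, ← mul_assoc, hr, one_mul, hamiltonian_eq, hB]
    push_cast
    module
  have hBn : ‖B‖ ≤ |E - lam / 2| + 1 := by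
    refine (norm_add_le _ _).trans (add_le_add ?_ (norm_permOp_le _))
    rw [norm_smul, Complex.norm_real, Real.norm_eq_abs]
    exact mul_le_of_le_one_right (abs_nonneg _) ContinuousLinearMap.norm_id_le
  have hA'n : ‖A'‖ ≤ 1 / s := by
    rw [hA', norm_smul, norm_inv, Complex.norm_real, Real.norm_eq_abs, abs_of_nonneg (sq_nonneg s)]
    calc (s ^ 2)⁻¹ * ‖A‖ ≤ (s ^ 2)⁻¹ * s :=
          mul_le_mul_of_nonneg_left (norm_cellPart_le lam ω) (by positivity)
      _ = 1 / s := by field_simp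
  have hsmall : ‖A' * B‖ < 1 := by
    calc ‖A' * B‖ ≤ ‖A'‖ * ‖B‖ := norm_mul_le _ _
      _ ≤ 1 / s * (|E - lam / 2| + 1) := mul_le_mul hA'n hBn (norm_nonneg _) (by positivity)
      _ < 1 := by rw [one_div, inv_mul_lt_iff₀ hs0]; linarith
  have hAunit : IsUnit A := ⟨⟨A, A', hr, hl⟩, rfl⟩
  rw [hfac, IsUnit.neg_iff]
  exact hAunit.mul (isUnit_one_sub_of_norm_lt_one hsmall)

/-- Approximate eigenvectors with bounded errors and unbounded norms exclude a bounded inverse. -/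
theorem mem_spec_of_approx {lam : ℝ} {ω : Config} {E M : ℝ}
    (h : ∀ N : ℕ, ∃ u : Ell2, (N : ℝ) ≤ ‖u‖ ∧ ‖(E : ℂ) • u - hamiltonian lam ω u‖ ≤ M) :
    E ∈ spec lam ω := by
  rw [mem_spec_iff]
  rintro ⟨T, hT⟩
  set R : Ell2 →L[ℂ] Ell2 := ↑T⁻¹ with hR
  obtain ⟨N, hN⟩ := exists_nat_gt (‖R‖ * M)
  obtain ⟨u, hu, hM⟩ := h N
  have h1 : R ((E : ℂ) • u - hamiltonian lam ω u) = u := by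
    have : (T : Ell2 →L[ℂ] Ell2) u = (E : ℂ) • u - hamiltonian lam ω u := by rw [hT]; rfl
    rw [← this]
    exact congrArg (fun S : Ell2 →L[ℂ] Ell2 => S u) T.inv_mul
  have h2 := R.le_opNorm ((E : ℂ) • u - hamiltonian lam ω u)
  rw [h1] at h2
  have h3 := mul_le_mul_of_nonneg_left hM (norm_nonneg R)
  linarith

/-- The operator of multiplication by `(-1) ^ n`. -/
def alternateOp : Ell2 →L[ℂ] Ell2 :=
  LinearMap.mkContinuous
    { toFun := fun u => ⟨fun n => (if Even n then 1 else -1) * u n, by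
        refine (lp.memℓp u).mono' fun n => ?_
        split_ifs <;> simp⟩
      map_add' := fun u v => by ext n; exact mul_add _ _ _
      map_smul' := fun c u => by ext n; exact mul_left_comm _ c _ } 1 (by
    intro u
    rw [one_mul]
    refine lp.norm_mono (by simp) fun n => ?_
    show ‖(if Even n then (1 : ℂ) else -1) * u n‖ ≤ ‖u n‖
    split_ifs <;> simp)

theorem alternateOp_apply (u : Ell2) (n : ℤ) :
    alternateOp u n = (if Even n then 1 else -1) * u n := rfl

theorem alternateOp_mul_self : alternateOp * alternateOp = 1 := by
  ext u n
  show alternateOp (alternateOp u) n = u n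
  rw [alternateOp_apply, alternateOp_apply]
  split_ifs <;> simp

theorem alternateOp_conj (lam : ℝ) (ω : Config) :
    alternateOp * hamiltonian lam (flip ω) * alternateOp = (lam : ℂ) • 1 - hamiltonian lam ω := by
  ext u n
  show alternateOp (hamiltonian lam (flip ω) (alternateOp u)) n
    = (lam : ℂ) * u n - hamiltonian lam ω u n
  rw [alternateOp_apply, hamiltonian_apply, hamiltonian_apply, alternateOp_apply,
    alternateOp_apply, alternateOp_apply, potential_flip]
  have h1 : Even (n - 1) ↔ ¬ Even n := by rw [Int.even_sub]; simp
  have h2 : Even (n + 1) ↔ ¬ Even n := by rw [Int.even_add]; simp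
  simp only [h1, h2]
  push_cast
  by_cases h : Even n <;> simp [h] <;> ring

/-- The reflection symmetry of the spectrum. -/
theorem sub_mem_spec_flip {lam : ℝ} {ω : Config} {E : ℝ} :
    lam - E ∈ spec lam (flip ω) ↔ E ∈ spec lam ω := by
  rw [mem_spec_iff, mem_spec_iff, not_iff_not]
  have hu : IsUnit alternateOp :=
    ⟨⟨_, _, alternateOp_mul_self, alternateOp_mul_self⟩, rfl⟩
  have h : (E : ℂ) • (1 : Ell2 →L[ℂ] Ell2) - hamiltonian lam ω
      = -(alternateOp * (((lam - E : ℝ) : ℂ) • 1 - hamiltonian lam (flip ω)) * alternateOp) := by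
    rw [mul_sub, sub_mul, alternateOp_conj, mul_smul_comm, smul_mul_assoc, mul_one,
      alternateOp_mul_self]
    push_cast
    module
  rw [h, IsUnit.neg_iff, hu.mul_right_iff, hu.mul_left_iff]

/-! ### The band edges belong to the spectrum -/

/-- The `4`-periodic sequence `1, c, c, 1`, starting at `m = 1`. -/
def periodicFn (c : ℝ) (m : ℤ) : ℝ := if m % 4 = 0 ∨ m % 4 = 1 then 1 else c

theorem periodicFn_equation {lam c : ℝ} (hc : c ^ 2 + lam * c = 1) {ω : Config} {j : ℤ} {N : ℕ}
    (hω : ∀ i : ℕ, i < 2 * N → ω (j + i) = if i % 2 = 0 then 1 else 0) {m : ℤ} (h0 : 0 < m)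
    (hm : m ≤ 4 * N) :
    (potential lam ω (2 * j + m) - (-1 - c)) * periodicFn c m
      = periodicFn c (m - 1) + periodicFn c (m + 1) := by
  obtain ⟨k, hk⟩ : ∃ k : ℕ, m = 2 * k + 1 ∨ m = 2 * k + 2 := ⟨((m - 1) / 2).toNat, by omega⟩
  have hcell := hω k (by omega)
  rcases hk with rfl | rfl
  · rw [show 2 * j + (2 * (k : ℤ) + 1) = 2 * (j + k) + 1 by ring, potential_odd, hcell]
    unfold periodicFn
    by_cases h : k % 2 = 0
    · rw [if_pos h, if_neg one_ne_zero, if_pos (by omega), if_pos (by omega), if_neg (by omega)]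
      ring
    · rw [if_neg h, if_pos rfl, if_neg (by omega), if_neg (by omega), if_pos (by omega)]
      linear_combination hc
  · rw [show 2 * j + (2 * (k : ℤ) + 2) = 2 * (j + k) + 2 by ring, potential_even, hcell]
    unfold periodicFn
    by_cases h : k % 2 = 0
    · rw [if_pos h, if_neg one_ne_zero, if_neg (by omega), if_pos (by omega), if_neg (by omega)]
      linear_combination hc
    · rw [if_neg h, if_pos rfl, if_pos (by omega), if_neg (by omega), if_pos (by omega)]
      ring

/-- The periodic sequence cut off outside `{2j + 1, …, 2j + 4N}`. -/
def cutoffFn (c : ℝ) (j : ℤ) (N : ℕ) (n : ℤ) : ℝ :=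
  if 0 < n - 2 * j ∧ n - 2 * j ≤ 4 * N then periodicFn c (n - 2 * j) else 0

theorem cutoffFn_support (c : ℝ) (j : ℤ) (N : ℕ) {n : ℤ}
    (hn : n ∉ Finset.Icc (2 * j + 1) (2 * j + 4 * N)) : cutoffFn c j N n = 0 := by
  rw [Finset.mem_Icc] at hn
  exact if_neg (by omega)

/-- The cut-off sequence as a vector of `ℓ²(ℤ)`. -/
def cutoffVec (c : ℝ) (j : ℤ) (N : ℕ) : Ell2 :=
  ⟨fun n => (cutoffFn c j N n : ℂ), by
    refine memℓp_gen (summable_of_ne_finset_zero (s := Finset.Icc (2 * j + 1) (2 * j + 4 * N))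
      fun n hn => ?_)
    rw [cutoffFn_support c j N hn]
    simp⟩

theorem cutoffVec_apply (c : ℝ) (j : ℤ) (N : ℕ) (n : ℤ) :
    cutoffVec c j N n = (cutoffFn c j N n : ℂ) := rfl

theorem le_norm_cutoffVec (c : ℝ) (j : ℤ) (N : ℕ) : (N : ℝ) ≤ ‖cutoffVec c j N‖ ^ 2 := by
  have h1 : Function.Injective fun i : ℕ => 2 * j + 4 * (i : ℤ) + 1 := fun a b h => by
    simp only at h; omega
  have h := sum_le_hasSum ((Finset.range N).map ⟨_, h1⟩) (fun n _ => by positivity)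
    (hasSum_norm_sq (cutoffVec c j N))
  rw [Finset.sum_map] at h
  refine le_trans (le_of_eq ?_) h
  rw [Finset.sum_congr rfl (g := fun _ => (1 : ℝ))]
  · simp
  · intro i hi
    have := Finset.mem_range.1 hi
    simp only [Function.Embedding.coeFn_mk, cutoffVec_apply]
    rw [cutoffFn, if_pos (by omega), periodicFn, if_pos (by omega)]
    simp

theorem norm_cutoffVec_sub_le {lam c : ℝ} (hc : c ^ 2 + lam * c = 1) {ω : Config} {j : ℤ} {N : ℕ}
    (hω : ∀ i : ℕ, i < 2 * N → ω (j + i) = if i % 2 = 0 then 1 else 0) :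
    ‖((-1 - c : ℝ) : ℂ) • cutoffVec c j N - hamiltonian lam ω (cutoffVec c j N)‖ ^ 2 ≤ 4 := by
  set v := ((-1 - c : ℝ) : ℂ) • cutoffVec c j N - hamiltonian lam ω (cutoffVec c j N) with hv
  have hval : ∀ n, v n = ((cutoffFn c j N (n - 1) + cutoffFn c j N (n + 1)
      - (potential lam ω n - (-1 - c)) * cutoffFn c j N n : ℝ) : ℂ) := fun n => by
    have : v n = ((-1 - c : ℝ) : ℂ) * cutoffVec c j N n
        - hamiltonian lam ω (cutoffVec c j N) n := rfl
    rw [this, hamiltonian_apply]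
    simp only [cutoffVec_apply]
    push_cast
    ring
  let s : Finset ℤ := {2 * j, 2 * j + 1, 2 * j + 4 * N, 2 * j + 4 * N + 1}
  have hs : s.card ≤ 4 := Finset.card_le_four
  have hin : ∀ m : ℤ, 0 < m → m ≤ 4 * N → cutoffFn c j N (2 * j + m) = periodicFn c m := by
    intro m h0 hm
    rw [cutoffFn, if_pos (by omega), add_sub_cancel_left]
  have hout : ∀ m : ℤ, m ≤ 0 ∨ 4 * N < m → cutoffFn c j N (2 * j + m) = 0 := by
    intro m hm
    exact if_neg (by omega)
  have hvm : ∀ m : ℤ, v (2 * j + m) = ((cutoffFn c j N (2 * j + (m - 1))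
      + cutoffFn c j N (2 * j + (m + 1))
      - (potential lam ω (2 * j + m) - (-1 - c)) * cutoffFn c j N (2 * j + m) : ℝ) : ℂ) :=
    fun m => by rw [hval, ← add_sub_assoc, ← add_assoc]
  have hvin : ∀ m : ℤ, 0 < m → m ≤ 4 * N → v (2 * j + m) =
      ((cutoffFn c j N (2 * j + (m - 1)) - periodicFn c (m - 1)
        + (cutoffFn c j N (2 * j + (m + 1)) - periodicFn c (m + 1)) : ℝ) : ℂ) := by
    intro m h0 hm
    rw [hvm, hin m h0 hm, periodicFn_equation hc hω h0 hm]
    congr 1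
    ring
  have hper : ∀ q : ℤ, periodicFn c (4 * q) = 1 ∧ periodicFn c (4 * q + 1) = 1 := fun q =>
    ⟨if_pos (by omega), if_pos (by omega)⟩
  have hcases : ∀ m : ℤ, (m = 0 ∨ m = 1 ∨ m = 4 * N ∨ m = 4 * N + 1 → ‖v (2 * j + m)‖ ^ 2 ≤ 1) ∧
      (¬ (m = 0 ∨ m = 1 ∨ m = 4 * N ∨ m = 4 * N + 1) → v (2 * j + m) = 0) := by
    intro m
    rcases lt_or_ge 0 m with h0 | h0
    · rcases le_or_gt m (4 * N) with h1 | h1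
      · rcases eq_or_ne m 1 with rfl | h2
        · refine ⟨fun _ => ?_, fun h => absurd (by omega) h⟩
          rw [hvin 1 h0 h1, hout (1 - 1) (by omega), hin (1 + 1) (by omega) (by omega), sub_self]
          have := (hper 0).1
          rw [mul_zero] at this
          simp [this]
        · rcases eq_or_ne m (4 * N) with rfl | h3
          · refine ⟨fun _ => ?_, fun h => absurd (by omega) h⟩
            rw [hvin _ h0 h1, hout (4 * N + 1) (by omega), hin (4 * N - 1) (by omega) (by omega),
              (hper N).2]
            simp
          · refine ⟨fun h => absurd h (by omega), fun _ => ?_⟩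
            rw [hvin _ h0 h1, hin _ (by omega) (by omega), hin _ (by omega) (by omega)]
            simp
      · rw [hvm, hout m (by omega), hout (m + 1) (by omega)]
        rcases eq_or_ne m (4 * N + 1) with rfl | h2
        · refine ⟨fun _ => ?_, fun h => absurd (by omega) h⟩
          rw [add_sub_cancel_right]
          rcases Nat.eq_zero_or_pos N with rfl | hN
          · rw [hout _ (by simp)]; simp
          · rw [hin _ (by omega) (by omega), (hper N).1]; simp
        · refine ⟨fun h => absurd h (by omega), fun _ => ?_⟩
          rw [hout (m - 1) (by omega)]
          simp
    · rw [hvm, hout m (by omega), hout (m - 1) (by omega)]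
      rcases eq_or_ne m 0 with rfl | h2
      · refine ⟨fun _ => ?_, fun h => absurd (by omega) h⟩
        rcases Nat.eq_zero_or_pos N with rfl | hN
        · rw [hout _ (by simp)]; simp
        · have := (hper 0).2
          rw [mul_zero] at this
          rw [hin _ (by omega) (by omega), this]; simp
      · refine ⟨fun h => ?_, fun _ => ?_⟩
        · rw [hout (m + 1) (by omega)]; simp
        · rw [hout (m + 1) (by omega)]; simp
  have hone : ∀ n ∈ s, ‖v n‖ ^ 2 ≤ 1 := by
    intro n hn
    simp only [s, Finset.mem_insert, Finset.mem_singleton] at hn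
    have := (hcases (n - 2 * j)).1 (by omega)
    rwa [add_sub_cancel] at this
  have hzero : ∀ n, n ∉ s → ‖v n‖ ^ 2 = 0 := by
    intro n hn
    simp only [s, Finset.mem_insert, Finset.mem_singleton] at hn
    have := (hcases (n - 2 * j)).2 (by omega)
    rw [add_sub_cancel] at this
    rw [this]; simp
  have h := (hasSum_norm_sq v).unique (hasSum_sum_of_ne_finset_zero hzero)
  rw [h]
  refine (Finset.sum_le_card_nsmul s _ 1 hone).trans ?_
  rw [nsmul_eq_mul, mul_one]
  exact_mod_cast hs

/-- A configuration with arbitrarily long alternating words has the energy `-1 - c` in its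
spectrum. -/
theorem mem_spec_of_alternating {lam c : ℝ} (hc : c ^ 2 + lam * c = 1) {ω : Config}
    (hω : ∀ N : ℕ, ∃ j : ℤ, ∀ i : ℕ, i < 2 * N → ω (j + i) = if i % 2 = 0 then 1 else 0) :
    -1 - c ∈ spec lam ω := by
  refine mem_spec_of_approx (M := 2) fun N => ?_
  obtain ⟨j, hj⟩ := hω (N ^ 2)
  refine ⟨cutoffVec c j (N ^ 2), ?_, ?_⟩
  · have := le_norm_cutoffVec c j (N ^ 2)
    push_cast at this
    exact (pow_le_pow_iff_left₀ (Nat.cast_nonneg _) (norm_nonneg _) two_ne_zero).1 this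
  · refine (pow_le_pow_iff_left₀ (norm_nonneg _) two_pos.le two_ne_zero).1 ?_
    refine (norm_cutoffVec_sub_le hc hj).trans ?_
    norm_num

theorem mem_asSpec {lam c : ℝ} (hc : c ^ 2 + lam * c = 1) : -1 - c ∈ asSpec lam := by
  have h : ∀ᵐ ω ∂law, ∀ N : ℕ, ∃ j : ℤ, ∀ i : Fin (2 * N),
      ω (j + (i : ℕ)) = if (i : ℕ) % 2 = 0 then 1 else 0 :=
    ae_all_iff.2 fun N => ae_exists_word _
  refine h.mono fun ω hω => mem_spec_of_alternating hc fun N => ?_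
  obtain ⟨j, hj⟩ := hω N
  exact ⟨j, fun i hi => hj ⟨i, hi⟩⟩

theorem sub_mem_asSpec {lam E : ℝ} (hE : E ∈ asSpec lam) : lam - E ∈ asSpec lam := by
  have h := measurePreserving_flip.quasiMeasurePreserving.ae (show ∀ᵐ ω ∂law, E ∈ spec lam ω from hE)
  refine h.mono fun ω hω => ?_
  have := sub_mem_spec_flip.2 hω
  rwa [flip_flip] at this

theorem abs_sub_le_of_mem_asSpec {lam E : ℝ} (hE : E ∈ asSpec lam) :
    |E - lam / 2| ≤ √((lam / 2) ^ 2 + 1) + 1 := by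
  obtain ⟨ω, hω⟩ := Filter.Eventually.exists (show ∀ᵐ ω ∂law, E ∈ spec lam ω from hE)
  exact abs_sub_le_of_mem_spec hω

theorem mem_spec_omegaStar {lam c : ℝ} (hc : c ^ 2 + lam * c = 1) :
    -1 - c ∈ spec lam omegaStar ∧ lam - (-1 - c) ∈ spec lam omegaStar := by
  refine ⟨mem_spec_of_alternating hc fun N => ⟨1, fun i _ => ?_⟩, ?_⟩
  · unfold omegaStar
    by_cases h : i % 2 = 0
    · rw [if_pos h, if_neg (by rw [Int.even_iff]; omega)]
    · rw [if_neg h, if_pos (by rw [Int.even_iff]; omega)]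
  · rw [← flip_flip omegaStar, sub_mem_spec_flip]
    refine mem_spec_of_alternating hc fun N => ⟨0, fun i _ => ?_⟩
    unfold flip omegaStar
    by_cases h : i % 2 = 0
    · rw [if_pos h, if_pos (by rw [if_pos]; rw [Int.even_iff]; omega)]
    · rw [if_neg h, if_neg (by rw [if_neg (by rw [Int.even_iff]; omega)]; exact one_ne_zero)]

/-! ### The values of the band edges -/

theorem lowerEdge_eq (lam : ℝ) : lowerEdge lam = lam / 2 - √((lam / 2) ^ 2 + 1) - 1 := by
  have hs : √((lam / 2) ^ 2 + 1) ^ 2 = (lam / 2) ^ 2 + 1 := Real.sq_sqrt (by positivity)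
  refine IsLeast.csInf_eq ⟨?_, fun E hE => ?_⟩
  · have := mem_asSpec (lam := lam) (c := √((lam / 2) ^ 2 + 1) - lam / 2) (by nlinarith)
    convert this using 1
    ring
  · linarith [(abs_le.1 (abs_sub_le_of_mem_asSpec hE)).1]

theorem upperEdge_eq (lam : ℝ) : upperEdge lam = lam - lowerEdge lam := by
  rw [lowerEdge_eq]
  have hs : √((lam / 2) ^ 2 + 1) ^ 2 = (lam / 2) ^ 2 + 1 := Real.sq_sqrt (by positivity)
  refine IsGreatest.csSup_eq ⟨?_, fun E hE => ?_⟩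
  · have := sub_mem_asSpec
      (mem_asSpec (lam := lam) (c := √((lam / 2) ^ 2 + 1) - lam / 2) (by nlinarith))
    convert this using 1
    ring
  · linarith [(abs_le.1 (abs_sub_le_of_mem_asSpec hE)).2]

theorem one_le_sqrt_half_sq_add_one (lam : ℝ) : 1 ≤ √((lam / 2) ^ 2 + 1) :=
  Real.one_le_sqrt.2 (by linarith [sq_nonneg (lam / 2)])

theorem gapUpper_eq (lam : ℝ) : gapUpper lam = lam / 2 + √((lam / 2) ^ 2 + 1) - 1 := by
  have hs : √((lam / 2) ^ 2 + 1) ^ 2 = (lam / 2) ^ 2 + 1 := Real.sq_sqrt (by positivity)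
  have hs1 := one_le_sqrt_half_sq_add_one lam
  refine IsLeast.csInf_eq ⟨⟨?_, ?_⟩, fun E hE => ?_⟩
  · have := (mem_spec_omegaStar (lam := lam) (c := -√((lam / 2) ^ 2 + 1) - lam / 2)
      (by nlinarith)).1
    convert this using 1
    ring
  · rw [Set.mem_Ici]; linarith
  · have h1 := le_abs_sub_of_mem_spec hE.1
    have h2 : lam / 2 ≤ E := hE.2
    rw [abs_of_nonneg (by linarith)] at h1
    linarith

theorem gapLower_eq (lam : ℝ) : gapLower lam = lam - gapUpper lam := by
  rw [gapUpper_eq]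
  have hs : √((lam / 2) ^ 2 + 1) ^ 2 = (lam / 2) ^ 2 + 1 := Real.sq_sqrt (by positivity)
  have hs1 := one_le_sqrt_half_sq_add_one lam
  refine IsGreatest.csSup_eq ⟨⟨?_, ?_⟩, fun E hE => ?_⟩
  · have := (mem_spec_omegaStar (lam := lam) (c := -√((lam / 2) ^ 2 + 1) - lam / 2)
      (by nlinarith)).2
    convert this using 1
    ring
  · rw [Set.mem_Iic]; linarith
  · have h1 := le_abs_sub_of_mem_spec hE.1
    have h2 : E ≤ lam / 2 := hE.2
    rw [abs_of_nonpos (by linarith)] at h1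
    linarith

/-! ### Growth of the integrated density of states at the edges -/

theorem measurable_walk (n : ℕ) : Measurable fun ω => walk ω n := by
  unfold walk
  refine Finset.measurable_sum _ fun k _ => ?_
  exact (Measurable.of_discrete (f := step)).comp (measurable_pi_apply (k : ℤ))

/-- On an excursion of the walk the growth function is small at both ends compared with the
middle. -/
theorem growth_bound_of_bump {c : ℝ} (hc0 : c ≠ 0) (hlog : Real.log c ≠ 0) {ω : Config} {m : ℕ}
    {δ : ℝ} (hδ : 0 < δ) (hδ8 : δ ≤ 1 / 8) (hm : -4 * Real.log δ ≤ |Real.log c| * √m)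
    (h1 : √m / 2 ≤ SignType.sign (Real.log c) * walk ω m)
    (h2 : SignType.sign (Real.log c) * (walk ω (m + m) - walk ω m) ≤ -(√m / 2)) :
    4 * (1 + growth c ω (m + m) ^ 2) ≤ δ ^ 2 * growth c ω m ^ 2 := by
  rw [growth_sq hc0, growth_sq hc0]
  set a := Real.log c with ha
  have habs : 0 < |a| := abs_pos.2 hlog
  have hsign : ∀ x : ℝ, a * x = |a| * (SignType.sign a * x) := fun x => by
    rw [← mul_assoc, mul_comm |a|, sign_mul_abs]
  have h3 : -2 * Real.log δ ≤ a * walk ω m := by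
    rw [hsign]; nlinarith
  have h4 : a * walk ω (m + m) ≤ a * walk ω m + 2 * Real.log δ := by
    have := hsign (walk ω (m + m) - walk ω m)
    nlinarith
  have hexp : Real.exp (4 * Real.log δ) = δ ^ 4 := by
    rw [mul_comm, ← Real.rpow_def_of_pos hδ]
    norm_cast
  have h5 : 1 ≤ Real.exp (2 * (a * walk ω m)) * δ ^ 4 := by
    rw [← hexp, ← Real.exp_add]
    exact Real.one_le_exp (by linarith)
  have h6 : Real.exp (2 * (a * walk ω (m + m))) ≤ Real.exp (2 * (a * walk ω m)) * δ ^ 4 := by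
    rw [← hexp, ← Real.exp_add]
    exact Real.exp_le_exp.2 (by linarith)
  have h7 : 8 * δ ^ 4 ≤ δ ^ 2 := by
    have h64 : δ ^ 2 ≤ 1 / 64 := by nlinarith
    nlinarith [mul_le_mul_of_nonneg_left h64 (sq_nonneg δ)]
  have h8 := Real.exp_pos (2 * (a * walk ω m))
  nlinarith

/-- The mechanism behind the logarithmic singularity. Suppose that the fraction `β / 2` of the
eigenvalues is at most `E₁`, below the edge `-1 - c`, for the boundary condition `1`, and that no
more are at most the edge itself for the boundary condition `0`. An excursion of the walk in a box
of `2m` cells, with `m` of order `log² δ`, produces one more eigenvalue below `-1 - c + δ`. -/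
theorem IDS_sub_ge {lam c : ℝ} (hc : c ^ 2 + lam * c = 1) (hlog : Real.log c ≠ 0) {β : ℕ}
    {E₁ : ℝ} (hE₁ : E₁ < -1 - c) (hlow : ∀ ω L, β * L ≤ eigCount lam 1 1 ω L E₁)
    (hup : ∀ ω L, eigCount lam 0 0 ω L (-1 - c) ≤ β * L) :
    ∃ C > (0 : ℝ), ∃ ε > (0 : ℝ), ∀ E ∈ Set.Ioo (-1 - c) (-1 - c + ε),
      C / Real.log (E - (-1 - c)) ^ 2 ≤ IDS lam E - IDS lam (-1 - c) := by
  have hc0 : c ≠ 0 := by rintro rfl; simp at hc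
  have habs : 0 < |Real.log c| := abs_pos.2 hlog
  -- With `m ≥ K log² δ` an excursion of height `√m / 2` gains a factor `δ ^ (-4)` in `growth ^ 2`.
  set K := (4 / |Real.log c|) ^ 2 with hK
  have hK0 : 0 < K := by positivity
  refine ⟨(3 / 40) ^ 2 / (4 * (K + 1)), by positivity, min (1 / 8) (-1 - c - E₁),
    lt_min (by norm_num) (by linarith), fun E hE => ?_⟩
  set δ := E - (-1 - c) with hδdef
  have hδ0 : 0 < δ := sub_pos.2 hE.1
  have hδ8 : δ ≤ 1 / 8 := by
    have := hE.2.trans_le (add_le_add_right (min_le_left _ _) _); linarith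
  have hδE₁ : E₁ < -1 - c - δ := by
    have := hE.2.trans_le (add_le_add_right (min_le_right _ _) _); linarith
  have hEδ : -1 - c + δ = E := by rw [hδdef]; ring
  have hlogδ : Real.log δ ≤ -1 := by
    rw [Real.log_le_iff_le_exp hδ0]
    refine hδ8.trans ?_
    rw [Real.exp_neg, one_div]
    exact inv_anti₀ (Real.exp_pos 1) (by linarith [Real.exp_one_lt_d9])
  have hlogsq : 1 ≤ Real.log δ ^ 2 := by nlinarith
  set m := ⌈K * Real.log δ ^ 2⌉₊ with hm
  have hm0 : 0 < m := Nat.ceil_pos.2 (by positivity)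
  have hmge : K * Real.log δ ^ 2 ≤ m := Nat.le_ceil _
  have hmle : (m : ℝ) ≤ (K + 1) * Real.log δ ^ 2 := by
    have := (Nat.ceil_lt_add_one (by positivity : 0 ≤ K * Real.log δ ^ 2)).le
    rw [← hm] at this
    linarith
  have hsqrt : -4 * Real.log δ ≤ |Real.log c| * √m := by
    have h1 : 4 / |Real.log c| * -Real.log δ ≤ √m := by
      refine Real.le_sqrt_of_sq_le ?_
      rw [mul_pow, neg_sq]
      exact hmge
    have h2 := mul_le_mul_of_nonneg_left h1 habs.le
    rw [← mul_assoc, mul_div_cancel₀ _ habs.ne'] at h2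
    linarith
  set G : Set Config := {ω | √m / 2 ≤ SignType.sign (Real.log c) * walk ω m ∧
      SignType.sign (Real.log c) * (walk ω (m + m) - walk ω m) ≤ -(√m / 2)} with hG
  have hGp : (3 / 40 : ℝ) ^ 2 ≤ law.real G := law_bump_ge hm0 (by
    rcases hlog.lt_or_gt with h | h
    · right; rw [sign_neg h]; simp
    · left; rw [sign_pos h]; simp)
  have hGm : MeasurableSet G := by
    rw [hG, Set.ofPred_and]
    exact (measurableSet_le measurable_const ((measurable_walk m).const_mul _)).inter
      (measurableSet_le (((measurable_walk (m + m)).sub (measurable_walk m)).const_mul _)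
        measurable_const)
  have hmean : β * (m + m : ℕ) + (3 / 40 : ℝ) ^ 2 ≤ meanCount lam 1 1 (m + m) E := by
    have hpt : ∀ ω, (β * (m + m : ℕ) : ℝ) + G.indicator 1 ω
        ≤ eigCount lam 1 1 ω (m + m) E := by
      intro ω
      by_cases hω : ω ∈ G
      · rw [Set.indicator_of_mem hω, Pi.one_apply]
        have h1 := eigCount_lt_of_growth hc ω (show m < m + m by omega) hδ0.le hδE₁
          (growth_bound_of_bump hc0 hlog hδ0 hδ8 hsqrt hω.1 hω.2)
        rw [hEδ] at h1
        have h2 := (Nat.add_le_add_right (hlow ω (m + m)) 1).trans h1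
        exact_mod_cast h2
      · rw [Set.indicator_of_notMem hω, add_zero]
        have h1 := (hlow ω (m + m)).trans
          (eigCount_mono lam 1 1 ω (m + m) (show E₁ ≤ E by linarith))
        exact_mod_cast h1
    have hind : Integrable (G.indicator (1 : Config → ℝ)) law :=
      (integrable_const (1 : ℝ)).indicator hGm
    have h3 := integral_mono ((integrable_const _).add hind)
      (integrable_eigCount lam 1 1 (m + m) E) hpt
    rw [Pi.add_def, integral_add (integrable_const _) hind, integral_indicator_one hGm] at h3
    simp only [integral_const, probReal_univ, one_smul] at h3
    exact (add_le_add_right hGp _).trans h3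
  have hIDS : IDS lam (-1 - c) ≤ β / 2 := by
    refine le_of_tendsto (tendsto_boxIDS lam (fun _ => 0) (fun _ => 0) (-1 - c)) ?_
    filter_upwards [eventually_gt_atTop 0] with L hL
    have hL' : (0 : ℝ) < L := by exact_mod_cast hL
    rw [boxIDS_eq, div_le_iff₀ (by positivity)]
    refine (meanCount_le_of_forall (C := β * L) fun ω => by exact_mod_cast hup ω L).trans
      (le_of_eq ?_)
    ring
  have hm0' : (0 : ℝ) < m := by exact_mod_cast hm0
  have hfinal : β / 2 + (3 / 40 : ℝ) ^ 2 / (4 * m) ≤ IDS lam E := by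
    refine le_trans ?_ (boxIDS_le_IDS lam E (show 0 < m + m by omega))
    rw [boxIDS_eq, le_div_iff₀ (by positivity)]
    refine le_trans (le_of_eq ?_) hmean
    push_cast
    field_simp
    ring
  have hcmp : (3 / 40 : ℝ) ^ 2 / (4 * (K + 1)) / Real.log δ ^ 2 ≤ (3 / 40 : ℝ) ^ 2 / (4 * m) := by
    rw [div_div]
    exact div_le_div_of_nonneg_left (by positivity) (by positivity) (by linarith)
  linarith

theorem lowerEdge_bound {lam : ℝ} (hlam : 0 < lam) :
    ∃ C > (0 : ℝ), ∃ ε > (0 : ℝ), ∀ E ∈ Set.Ioo (lowerEdge lam) (lowerEdge lam + ε),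
      C / Real.log (E - lowerEdge lam) ^ 2 ≤ IDS lam E - IDS lam (lowerEdge lam) := by
  set s := √((lam / 2) ^ 2 + 1) with hs
  have hs2 : s ^ 2 = (lam / 2) ^ 2 + 1 := Real.sq_sqrt (by positivity)
  have hs0 : 0 ≤ s := Real.sqrt_nonneg _
  have hc : (s - lam / 2) ^ 2 + lam * (s - lam / 2) = 1 := by nlinarith
  have hpos : 0 < s - lam / 2 := by nlinarith
  have hlt : s - lam / 2 < 1 := by nlinarith
  have hE : lowerEdge lam = -1 - (s - lam / 2) := by rw [lowerEdge_eq]; ring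
  rw [hE]
  -- With `β = 0` the energy `E₁` plays no role beyond lying below the edge.
  exact IDS_sub_ge hc (Real.log_neg hpos hlt).ne (β := 0) (sub_one_lt _)
    (fun ω L => by simp) (fun ω L => by rw [eigCount_eq_zero hc hpos]; simp)

theorem gapUpper_bound {lam : ℝ} (hlam : 0 < lam) :
    ∃ C > (0 : ℝ), ∃ ε > (0 : ℝ), ∀ E ∈ Set.Ioo (gapUpper lam) (gapUpper lam + ε),
      C / Real.log (E - gapUpper lam) ^ 2 ≤ IDS lam E - IDS lam (gapUpper lam) := by
  set s := √((lam / 2) ^ 2 + 1) with hs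
  have hs2 : s ^ 2 = (lam / 2) ^ 2 + 1 := Real.sq_sqrt (by positivity)
  have hs0 : 0 ≤ s := Real.sqrt_nonneg _
  have hc : (-s - lam / 2) ^ 2 + lam * (-s - lam / 2) = 1 := by nlinarith
  have hs1 : 1 < s := by nlinarith [sq_pos_of_pos hlam]
  have hlog : 0 < Real.log (-s - lam / 2) := by
    rw [← Real.log_neg_eq_log]
    exact Real.log_pos (by linarith)
  have hE : gapUpper lam = -1 - (-s - lam / 2) := by rw [gapUpper_eq]; ring
  rw [hE]
  exact IDS_sub_ge hc hlog.ne' (β := 1) (E₁ := lam + 1 + (-s - lam / 2)) (by linarith)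
    (fun ω L => by rw [one_mul]; exact half_le_eigCount hc ω L)
    (fun ω L => by rw [one_mul]; exact eigCount_le_half hc ω L)

/-- The reflection `E ↦ lam - E` turns a bound above `E₀` into a bound below `lam - E₀`. The loss
of a factor `2` in the distance avoids one-sided limits of the density of states. -/
theorem reflected_bound {lam E₀ : ℝ}
    (h : ∃ C > (0 : ℝ), ∃ ε > (0 : ℝ), ∀ E ∈ Set.Ioo E₀ (E₀ + ε),
      C / Real.log (E - E₀) ^ 2 ≤ IDS lam E - IDS lam E₀) :
    ∃ C > (0 : ℝ), ∃ ε > (0 : ℝ), ∀ E ∈ Set.Ioo (lam - E₀ - ε) (lam - E₀),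
      C / Real.log (lam - E₀ - E) ^ 2 ≤ IDS lam (lam - E₀) - IDS lam E := by
  obtain ⟨C, hC, ε, hε, h⟩ := h
  refine ⟨C / 4, by positivity, min ε (1 / 2), lt_min hε (by norm_num), fun E hE => ?_⟩
  set δ := lam - E₀ - E with hδ
  have hδ0 : 0 < δ := sub_pos.2 hE.2
  have hδε : δ < min ε (1 / 2) := by linarith [hE.1]
  have hδ2 := hδε.trans_le (min_le_right _ _)
  have h1 := h (E₀ + δ / 2) ⟨by linarith, by linarith [hδε.trans_le (min_le_left _ _)]⟩
  rw [add_sub_cancel_left] at h1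
  have h2 := one_le_IDS_add lam E₀
  have h3 := IDS_add_le_one lam (E := E) (E' := E₀ + δ / 2) (by rw [hδ]; linarith)
  have hl2 : Real.log δ ≤ -Real.log 2 := by
    rw [← Real.log_inv]
    exact Real.log_le_log hδ0 (by linarith)
  have hlog2 : 0 < Real.log 2 := Real.log_pos one_lt_two
  have hlog : Real.log (δ / 2) = Real.log δ - Real.log 2 := Real.log_div hδ0.ne' two_ne_zero
  have hle : Real.log (δ / 2) ^ 2 ≤ 4 * Real.log δ ^ 2 := by rw [hlog]; nlinarith
  have hpos : 0 < Real.log (δ / 2) ^ 2 := sq_pos_of_neg (by rw [hlog]; linarith)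
  have h4 : C / 4 / Real.log δ ^ 2 ≤ C / Real.log (δ / 2) ^ 2 := by
    rw [div_div]
    exact div_le_div_of_nonneg_left hC.le hpos hle
  linarith

/-- No power of `x` dominates `1 / log² x` at `0`. -/
theorem not_holderContinuousAt {f : ℝ → ℝ} {x₀ s C ε : ℝ} (hs : |s| = 1) (hC : 0 < C) (hε : 0 < ε)
    (h : ∀ x ∈ Set.Ioo 0 ε, C / Real.log x ^ 2 ≤ |f (x₀ + s * x) - f x₀|) :
    ¬ HolderContinuousAt f x₀ := by
  rintro ⟨γ, hγ, K, δ, hδ, hf⟩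
  have hlim : Tendsto (fun x : ℝ => K * (Real.log x * x ^ (γ / 2)) ^ 2) (𝓝[>] 0) (𝓝 0) := by
    have := ((tendsto_log_mul_rpow_nhdsGT_zero (half_pos hγ)).pow 2).const_mul K
    simpa using this
  have hle : ∀ᶠ x in 𝓝[>] (0 : ℝ), C ≤ K * (Real.log x * x ^ (γ / 2)) ^ 2 := by
    have hmem : Set.Ioo 0 (min (min ε δ) 1) ∈ 𝓝[>] (0 : ℝ) :=
      Ioo_mem_nhdsGT (lt_min (lt_min hε hδ) one_pos)
    filter_upwards [hmem] with x hx
    have hx1 : x < 1 := hx.2.trans_le (min_le_right _ _)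
    have hxε : x < ε := hx.2.trans_le ((min_le_left _ _).trans (min_le_left _ _))
    have hxδ : x < δ := hx.2.trans_le ((min_le_left _ _).trans (min_le_right _ _))
    have habs : |x₀ + s * x - x₀| = x := by
      rw [add_sub_cancel_left, abs_mul, hs, one_mul, abs_of_pos hx.1]
    have h1 := hf (x₀ + s * x) (by rwa [habs])
    rw [habs] at h1
    have hlog : 0 < Real.log x ^ 2 := sq_pos_of_neg (Real.log_neg hx.1 hx1)
    have h2 := (h x ⟨hx.1, hxε⟩).trans h1
    rw [div_le_iff₀ hlog] at h2
    refine h2.trans (le_of_eq ?_)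
    rw [mul_pow, ← Real.rpow_natCast (x ^ (γ / 2)) 2, ← Real.rpow_mul hx.1.le]
    norm_num
    ring
  exact absurd (ge_of_tendsto hlim hle) (not_le.2 hC)

end BDM

end

theorem theorem2p8 (lam : ℝ) (hlam : 0 < lam) :
    -- the limit defining the IDS exists and does not depend on the boundary conditions
    (∀ (a b : ℕ → ℝ) (E : ℝ),
      Tendsto (fun L : ℕ => BDM.boxIDS lam (a L) (b L) L E) atTop (𝓝 (BDM.IDS lam E))) ∧
    (∀ E₀ : ℝ, E₀ = BDM.lowerEdge lam ∨ E₀ = BDM.gapUpper lam →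
      ∃ C > (0 : ℝ), ∃ ε > (0 : ℝ), ∀ E ∈ Set.Ioo E₀ (E₀ + ε),
        C / Real.log (E - E₀) ^ 2 ≤ BDM.IDS lam E - BDM.IDS lam E₀) ∧
    (∀ E₀ : ℝ, E₀ = BDM.upperEdge lam ∨ E₀ = BDM.gapLower lam →
      ∃ C > (0 : ℝ), ∃ ε > (0 : ℝ), ∀ E ∈ Set.Ioo (E₀ - ε) E₀,
        C / Real.log (E₀ - E) ^ 2 ≤ BDM.IDS lam E₀ - BDM.IDS lam E) ∧
    (∀ E₀ : ℝ, E₀ = BDM.lowerEdge lam ∨ E₀ = BDM.upperEdge lam ∨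
        E₀ = BDM.gapLower lam ∨ E₀ = BDM.gapUpper lam →
      ¬ BDM.HolderContinuousAt (BDM.IDS lam) E₀) := by
  have hlower := BDM.lowerEdge_bound hlam
  have hgapUpper := BDM.gapUpper_bound hlam
  have hupper := BDM.reflected_bound hlower
  have hgapLower := BDM.reflected_bound hgapUpper
  rw [← BDM.upperEdge_eq] at hupper
  rw [← BDM.gapLower_eq] at hgapLower
  have hright : ∀ E₀ : ℝ, (∃ C > (0 : ℝ), ∃ ε > (0 : ℝ), ∀ E ∈ Set.Ioo E₀ (E₀ + ε),
      C / Real.log (E - E₀) ^ 2 ≤ BDM.IDS lam E - BDM.IDS lam E₀) →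
      ¬ BDM.HolderContinuousAt (BDM.IDS lam) E₀ := by
    rintro E₀ ⟨C, hC, ε, hε, h⟩
    refine BDM.not_holderContinuousAt (s := 1) abs_one hC hε fun x hx => ?_
    have := h (E₀ + 1 * x) ⟨by linarith [hx.1], by linarith [hx.2]⟩
    rw [show E₀ + 1 * x - E₀ = x by ring] at this
    exact this.trans (le_abs_self _)
  have hleft : ∀ E₀ : ℝ, (∃ C > (0 : ℝ), ∃ ε > (0 : ℝ), ∀ E ∈ Set.Ioo (E₀ - ε) E₀,
      C / Real.log (E₀ - E) ^ 2 ≤ BDM.IDS lam E₀ - BDM.IDS lam E) →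
      ¬ BDM.HolderContinuousAt (BDM.IDS lam) E₀ := by
    rintro E₀ ⟨C, hC, ε, hε, h⟩
    refine BDM.not_holderContinuousAt (s := -1) (by simp) hC hε fun x hx => ?_
    have := h (E₀ + -1 * x) ⟨by linarith [hx.2], by linarith [hx.1]⟩
    rw [show E₀ - (E₀ + -1 * x) = x by ring] at this
    rw [abs_sub_comm]
    exact this.trans (le_abs_self _)
  refine ⟨BDM.tendsto_boxIDS lam, ?_, ?_, ?_⟩
  · rintro E₀ (rfl | rfl)
    exacts [hlower, hgapUpper]
  · rintro E₀ (rfl | rfl)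
    exacts [hupper, hgapLower]
  · rintro E₀ (rfl | rfl | rfl | rfl)
    exacts [hright _ hlower, hleft _ hupper, hleft _ hgapLower, hright _ hgapUpper]
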